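/- Let $k\ge 2$ and $k\ge a\ge 1$ be integers. Let $W_{k,a}(n)$ be the number of partitions $\lambda_1\ge\lambda_2\ge\dots\ge\lambda_s>0$ of $n$ such that $\lambda_i-\lambda_{i+k-1}\ge 2$ whenever $1\le i\le s-k+1$, at most $a-1$ of the parts are equal to $1$, and every even part appears an even number of times. Consider lattice paths in the first quadrant that start on the $y$-axis, end on the $x$-axis, and use the steps $(x,y)\to(x+1,y+1)$ (North-East), $(x,y)\to(x+1,y-1)$ (South-East) and $(x,0)\to(x+1,0)$ (East, allowed only at height $0$), and that are either empty or end with a South-East step. The height of a vertex is its $y$-coordinate and its weight is its $x$-coordinate. A peak is a vertex preceded by a North-East step and followed by a South-East step, and the major index of a path is the sum of the weights of its peaks. A path satisfies the special $(k,a)$-conditions if it starts at height $k-a$ and all its vertices have height less than $k$. The relative height of a peak $(x,y)$ is the largest integer $h$ for which there are two vertices $(x',y-h)$ and $(x'',y-h)$ on the path with $x'<x<x''$ such that between these two vertices there is no peak of height $>y$ and every peak of height $y$ has weight $\ge x$. Let $P_{k,a}(n)$ be the number of lattice paths of major index $n$ that satisfy the special $(k,a)$-conditions and in which the weight and the relative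 height of every peak have the same parity. Then for every $n\ge 0$ the number $P_{k,a}(n)$ is finite and $$W_{k,a}(n)=P_{k,a}(n).$$ Moreover, as formal power series in $q$, $$\sum_{n\ge 0}P_{k,a}(n)q^n=\sum_{N_1\ge N_2\ge\cdots\ge N_{k-1}\ge 0}\frac{q^{N_1^2+N_2^2+\cdots+N_{k-1}^2+2N_a+2N_{a+2}+\cdots}}{(q^2;q^2)_{N_1-N_2}\cdots(q^2;q^2)_{N_{k-2}-N_{k-1}}(q^2;q^2)_{N_{k-1}}},$$ where the linear terms $2N_a+2N_{a+2}+\cdots$ run over the indices $i$ with $a\le i\le k-1$ and $i\equiv a \pmod 2$, and $(q^2;q^2)_m=\prod_{j=1}^{m}(1-q^{2j})$. -/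

import Mathlib

open scoped PowerSeries PowerSeries.WithPiTopology

namespace RRGPaths

/-! ### Restricted Rogers-Ramanujan-Gordon partitions -/

/-- The parts `λ₁ ≥ λ₂ ≥ ⋯ ≥ λₛ > 0` of a partition, listed in non-increasing order. -/
def sortedParts {n : ℕ} (p : n.Partition) : List ℕ := p.parts.sort (· ≥ ·)

/-- The condition defining `B_{k,a}(n)`: `λ_i - λ_{i+k-1} ≥ 2` for all `i` for which both parts
exist, and at most `a - 1` of the parts are equal to `1`. -/
def IsGordon (k a : ℕ) {n : ℕ} (p : n.Partition) : Prop :=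
  (∀ (i : ℕ) (hi : i + (k - 1) < (sortedParts p).length),
      (sortedParts p)[i + (k - 1)] + 2 ≤ (sortedParts p)[i]) ∧
    p.parts.count 1 ≤ a - 1

/-- Every even part appears an even number of times. -/
def EvenPartsEven {n : ℕ} (p : n.Partition) : Prop :=
  ∀ j ∈ p.parts, Even j → Even (p.parts.count j)

/-- `W_{k,a}(n)`. -/
noncomputable def W (k a n : ℕ) : ℕ :=
  Nat.card {p : n.Partition // IsGordon k a p ∧ EvenPartsEven p}

/-! ### Lattice paths -/

/-- The three unitary steps: North-East, South-East, East. -/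
inductive Step
  | NE
  | SE
  | E
  deriving DecidableEq

/-- The change of height along a step. -/
def Step.rise : Step → ℤ
  | NE => 1
  | SE => -1
  | E => 0

/-- The height of the vertex with abscissa `x` on the path which starts at `(0, s)` and follows
the list of steps `l`. -/
def heightAt (s : ℕ) (l : List Step) (x : ℕ) : ℤ := (s : ℤ) + ((l.take x).map Step.rise).sum

/-- A lattice path in the first quadrant that starts on the `y`-axis, ends on the `x`-axis, uses
East steps only at height `0`, and is either empty or ends with a South-East step. -/
@[ext] structure LatticePath where
  /-- the height of the starting point -/
  start : ℕ
  /-- the steps, from left to right -/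
  steps : List Step
  height_nonneg : ∀ x ≤ steps.length, 0 ≤ heightAt start steps x
  east_height : ∀ x, steps[x]? = some Step.E → heightAt start steps x = 0
  height_end : heightAt start steps steps.length = 0
  empty_or_end : steps = [] ∨ steps.getLast? = some Step.SE

namespace LatticePath

variable (L : LatticePath)

/-- The height of the vertex of weight (abscissa) `x`; vertices are those with
`x ≤ L.steps.length`. -/
def height (x : ℕ) : ℤ := heightAt L.start L.steps x

/-- The vertex of weight `x` is a peak: it is preceded by a North-East step and followed by a
South-East step. -/
def IsPeak (x : ℕ) : Prop :=
  0 < x ∧ L.steps[x - 1]? = some Step.NE ∧ L.steps[x]? = some Step.SE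

instance (x : ℕ) : Decidable (L.IsPeak x) := by
  unfold IsPeak; infer_instance

/-- The major index: the sum of the weights of the peaks. -/
def majorIndex : ℕ := ∑ x ∈ (Finset.range L.steps.length).filter L.IsPeak, x

/-- The special `(k,a)`-conditions (for `a ≤ k`): the path starts at height `k - a` and all its
heights are less than `k`. -/
def Special (k a : ℕ) : Prop :=
  (L.start : ℤ) = (k : ℤ) - (a : ℤ) ∧ ∀ x ≤ L.steps.length, L.height x < (k : ℤ)

/-- The integers `h` admitted in the definition of the relative height of the peak of
weight `x`. -/
def relHeightSet (x : ℕ) : Set ℤ :=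
  {h | ∃ x₁ x₂ : ℕ, x₁ < x ∧ x < x₂ ∧ x₂ ≤ L.steps.length ∧
    L.height x₁ = L.height x - h ∧ L.height x₂ = L.height x - h ∧
    ∀ z, x₁ < z → z < x₂ → L.IsPeak z →
      L.height z ≤ L.height x ∧ (L.height z = L.height x → x ≤ z)}

/-- The relative height of a peak: the largest element of `relHeightSet`. -/
noncomputable def relHeight (x : ℕ) : ℤ := sSup (L.relHeightSet x)

theorem height_succ {x : ℕ} {s : Step} (h : L.steps[x]? = some s) :
    L.height (x + 1) = L.height x + s.rise := by
  simp [height, heightAt, List.take_add_one, h, add_assoc]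

/-- For a peak, `relHeight` really is a largest element. -/
theorem isGreatest_relHeight {x : ℕ} (hx : L.IsPeak x) :
    IsGreatest (L.relHeightSet x) (L.relHeight x) := by
  obtain ⟨h0, h1, h2⟩ := hx
  have hlt : x < L.steps.length := (List.getElem?_eq_some_iff.1 h2).1
  have e1 := L.height_succ h1
  have e2 := L.height_succ h2
  rw [Nat.sub_add_cancel h0] at e1
  have hne : (L.relHeightSet x).Nonempty := by
    refine ⟨1, x - 1, x + 1, by omega, by omega, by omega, ?_, ?_, ?_⟩
    · simp only [Step.rise] at e1; omega
    · simp only [Step.rise] at e2; omega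
    · intro z hz1 hz2 _
      obtain rfl : z = x := by omega
      exact ⟨le_rfl, fun _ => le_rfl⟩
  have hbd : BddAbove (L.relHeightSet x) := by
    refine ⟨L.height x, ?_⟩
    rintro h ⟨x₁, x₂, _, _, hx₂, _, hh, _⟩
    have := L.height_nonneg x₂ hx₂
    change 0 ≤ L.height x₂ at this
    omega
  exact ⟨Int.csSup_mem hne hbd, fun h hh => le_csSup hbd hh⟩

end LatticePath

/-- The lattice paths counted by `P_{k,a}(n)`: those satisfying the special `(k,a)`-conditions,
with major index `n`, all of whose peaks have weight and relative height of the same parity. -/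
def parityPaths (k a n : ℕ) : Set LatticePath :=
  {L | L.Special k a ∧ L.majorIndex = n ∧
    ∀ x, L.IsPeak x → (Even (x : ℤ) ↔ Even (L.relHeight x))}

/-- `P_{k,a}(n)`. -/
noncomputable def P (k a n : ℕ) : ℕ := (parityPaths k a n).ncard

/-! ### The multisum -/

/-- `(q²; q²)_m = (1 - q²)(1 - q⁴) ⋯ (1 - q^{2m})` as a formal power series. -/
noncomputable def qqPoch (m : ℕ) : ℤ⟦X⟧ :=
  ∏ i ∈ Finset.range m, (1 - (PowerSeries.X : ℤ⟦X⟧) ^ (2 * (i + 1)))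

/-- The formal power series `1 / (q²; q²)_m`. -/
noncomputable def invQQPoch (m : ℕ) : ℤ⟦X⟧ := PowerSeries.invOfUnit (qqPoch m) 1

theorem qqPoch_mul_inv (m : ℕ) : qqPoch m * invQQPoch m = 1 := by
  apply PowerSeries.mul_invOfUnit
  simp [qqPoch, map_prod]

/-- The sequences `N_1 ≥ N_2 ≥ ⋯ ≥ N_{k-1} ≥ 0`. -/
abbrev MultiIndex (k : ℕ) : Type := {N : Fin (k - 1) → ℕ // Antitone N}

/-- The entry `N_i` for `1 ≤ i ≤ k - 1`, and `0` otherwise (so `N_k = 0`). -/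
def MultiIndex.entry {k : ℕ} (N : MultiIndex k) (i : ℕ) : ℕ :=
  if h : 1 ≤ i ∧ i ≤ k - 1 then N.1 ⟨i - 1, by omega⟩ else 0

/-- The exponent `N_1² + ⋯ + N_{k-1}² + 2 N_a + 2 N_{a+2} + ⋯`, where the linear terms run over
the indices `i ≤ k - 1` with `i ≥ a` and `i ≡ a` modulo `2`. -/
def MultiIndex.exponent {k : ℕ} (a : ℕ) (N : MultiIndex k) : ℕ :=
  ∑ i ∈ Finset.Icc 1 (k - 1), N.entry i ^ 2 +
    ∑ i ∈ (Finset.Icc a (k - 1)).filter (fun i => i % 2 = a % 2), 2 * N.entry i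

/-- The summand
`q^{exponent} / ((q²;q²)_{N_1-N_2} ⋯ (q²;q²)_{N_{k-2}-N_{k-1}} (q²;q²)_{N_{k-1}})`. -/
noncomputable def MultiIndex.summand {k : ℕ} (a : ℕ) (N : MultiIndex k) : ℤ⟦X⟧ :=
  PowerSeries.X ^ N.exponent a *
    ∏ i ∈ Finset.Icc 1 (k - 1), invQQPoch (N.entry i - N.entry (i + 1))

end RRGPaths

/-!
All three quantities are identified with one multisum, by recurrences in `q = X` which have only one
solution tending to the right limit `q`-adically (`eq_zero_of_X_pow_dvd`). Write `k = d + 1`.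

**Partitions.** In terms of frequencies `f_j`, the conditions are `f_j + f_{j+1} ≤ k - 1`,
`f_1 ≤ a - 1`, and `f_j` even for even `j` (`diff_condition_iff`). Removing the copies of the
smallest admissible part gives a recurrence for the generating functions of the partitions into parts `≥ s`
with `f_s ≤ c` (`genFun_gordonSet_succ`). The multisum with the additional factor
`x^{N_1 + ⋯ + N_{k-1}}`, at `x = q^{2m}`, is `gordonSum`; raising all summation variables by the
last one expresses it through the multisum for `k - 1`. By induction on `k` it satisfies two functional
equations, for `a ≡ k` and for `a ≢ k` modulo `2` (`gordonSum_functional`): the equation for `k`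
reduces to the other one for `k - 1` and to a shift of the last summation variable. They amount to
the recurrence of the partitions (`genFun_gordonSet_eq`).

**Paths.** The condition that weight and relative height of each peak have the same parity is
equivalent to a local one: every run of North-East steps starts at an even weight. Indeed the
vertex from which the relative height of a peak is measured is the start of such a run, is not
separated from the peak by East steps, and each start of a run other than the initial vertex plays
this role for some peak (`LatticePath.AscentsEven.parity`, `LatticePath.ascentsEven_of_parity`).
Removing the first step then gives a recurrence for the generating functions of the paths by
starting weight, starting height and direction of the step before
(`genFun_pathSet_true`, `genFun_pathSet_false`). The multisum with the additional factor `z^{N_1}`,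
at `z = q^{2m}`, is `pathSum`; its coefficients in `z` are obtained from those for `k - 1` by
convolution with `1 / (q²; q²)_m`, which yields a recurrence in `a` by induction on `k`
(`innerSum_rec`, `pathSum_rec`), and this is the recurrence of the paths (`genFun_pathSet_eq`).

**The multisum.** `gordonSum` and `pathSum` are built from opposite ends of the sequence
`N_1 ≥ ⋯ ≥ N_{k-1}`. At `m = 0` both are the sum of the same summable family
(`MultiIndex.hasSum_summand_gordonSum`, `MultiIndex.hasSum_summand_pathSum`).
-/

namespace RRGPaths
open PowerSeries

/-! ### Power series in one variable -/

theorem invQQPoch_zero : invQQPoch 0 = 1 := by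
  simpa [qqPoch] using qqPoch_mul_inv 0

/-- `1 / (q²; q²)_{m+1} · (1 - q^{2(m+1)}) = 1 / (q²; q²)_m`. -/
theorem invQQPoch_succ_mul (m : ℕ) :
    invQQPoch (m + 1) * (1 - (X : ℤ⟦X⟧) ^ (2 * (m + 1))) = invQQPoch m := by
  have h1 := qqPoch_mul_inv (m + 1)
  have h2 := qqPoch_mul_inv m
  rw [qqPoch, Finset.prod_range_succ, ← qqPoch] at h1
  linear_combination (invQQPoch m) * h1 -
    (invQQPoch (m + 1) * (1 - (X : ℤ⟦X⟧) ^ (2 * (m + 1)))) * h2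

theorem summable_of_X_pow_dvd {ι : Type*} {f : ι → ℤ⟦X⟧} (g : ι → ℕ)
    (hg : ∀ n, {i | g i ≤ n}.Finite) (h : ∀ i, (X : ℤ⟦X⟧) ^ g i ∣ f i) : Summable f := by
  rw [PowerSeries.WithPiTopology.summable_iff_summable_coeff]
  intro n
  refine summable_of_hasFiniteSupport ((hg n).subset fun i hi => ?_)
  by_contra hlt
  exact hi (X_pow_dvd_iff.1 (h i) n (not_le.1 hlt))

theorem summable_nat_of_X_pow_dvd {f : ℕ → ℤ⟦X⟧} (h : ∀ n, (X : ℤ⟦X⟧) ^ n ∣ f n) :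
    Summable f :=
  summable_of_X_pow_dvd id (fun n => Set.finite_Iic n) h

theorem X_pow_dvd_tsum {ι : Type*} {f : ι → ℤ⟦X⟧} (n : ℕ) (h : ∀ i, (X : ℤ⟦X⟧) ^ n ∣ f i)
    (hf : Summable f) : (X : ℤ⟦X⟧) ^ n ∣ ∑' i, f i := by
  rw [X_pow_dvd_iff]
  intro j hj
  have := ((PowerSeries.WithPiTopology.hasSum_iff_hasSum_coeff ℤ).1 hf.hasSum) j
  have h0 : ∀ i, coeff j (f i) = 0 := fun i => X_pow_dvd_iff.1 (h i) j hj
  simp only [h0] at this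
  exact this.unique hasSum_zero

/-- A family of power series which is determined, modulo every power of `q`, by the next one, and
tends to zero `q`-adically, vanishes. -/
theorem eq_zero_of_X_pow_dvd {ι : Type*} {D : ℕ → ι → ℤ⟦X⟧} (c : ℕ)
    (h0 : ∀ m i, (X : ℤ⟦X⟧) ^ (m - c) ∣ D m i)
    (hstep : ∀ m N, (∀ i, (X : ℤ⟦X⟧) ^ N ∣ D (m + 1) i) → ∀ i, (X : ℤ⟦X⟧) ^ N ∣ D m i)
    (m : ℕ) (i : ι) : D m i = 0 := by
  have key : ∀ N j m, N + c ≤ m + j → ∀ i, (X : ℤ⟦X⟧) ^ N ∣ D m i := by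
    intro N j
    induction j with
    | zero => exact fun m hm i => (pow_dvd_pow _ (by omega)).trans (h0 m i)
    | succ j ih => exact fun m hm => hstep m N (ih (m + 1) (by omega))
  ext n
  simpa using X_pow_dvd_iff.1 (key (n + 1) (n + 1 + c) m (by omega) i) n (by omega)

/-! ### The multisum as a function of the parts, and its functional equations -/

/-- `gordonSum d a m` is the multisum for `k = d + 1`, with an additional factor
`x^{N_1 + ⋯ + N_{k-1}}` specialised at `x = q^{2m}`. It is defined by summing over the innermost
variable `N_{k-1} = N` last, after all other variables have been lowered by `N`; there are
`(k + 1 - a) / 2` linear terms. For `a = 0` the value is `0`, the count of the partitions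
in which the part `1` occurs fewer than `a` times. -/
noncomputable def gordonSum : ℕ → ℕ → ℕ → ℤ⟦X⟧
  | 0, a, _ => if a = 0 then 0 else 1
  | d + 1, a, m => ∑' N, X ^ ((d + 1) * (N ^ 2 + 2 * m * N)) * invQQPoch N *
      X ^ (2 * N * ((d + 3 - a) / 2)) * gordonSum d a (m + N)

theorem gordonSum_term_dvd (d e m N : ℕ) (g : ℤ⟦X⟧) :
    (X : ℤ⟦X⟧) ^ N ∣ X ^ ((d + 1) * (N ^ 2 + 2 * m * N)) * invQQPoch N * X ^ e * g := by
  have : N ≤ (d + 1) * (N ^ 2 + 2 * m * N) := by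
    nlinarith [Nat.le_self_pow two_ne_zero N, Nat.zero_le (m * N),
      Nat.zero_le (d * (N ^ 2 + 2 * m * N))]
  exact ((((pow_dvd_pow _ this).mul_right _).mul_right _).mul_right _)

theorem hasSum_gordonSum (d a m : ℕ) :
    HasSum (fun N => (X : ℤ⟦X⟧) ^ ((d + 1) * (N ^ 2 + 2 * m * N)) * invQQPoch N *
      X ^ (2 * N * ((d + 3 - a) / 2)) * gordonSum d a (m + N)) (gordonSum (d + 1) a m) := by
  rw [gordonSum]
  exact (summable_nat_of_X_pow_dvd fun N => gordonSum_term_dvd d _ m N _).hasSum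

theorem gordonSum_zero (d m : ℕ) : gordonSum d 0 m = 0 := by
  induction d generalizing m with
  | zero => simp [gordonSum]
  | succ d ih => simp [gordonSum, ih]

theorem gordonSum_of_lt {d a : ℕ} (h : d < a) (m : ℕ) :
    gordonSum d a m = gordonSum d (d + 1) m := by
  induction d generalizing a m with
  | zero => simp [gordonSum, show a ≠ 0 by omega]
  | succ d ih =>
    rw [gordonSum, gordonSum]
    refine tsum_congr fun N => ?_
    rw [ih (a := a) (by omega), ih (a := d + 1 + 1) (by omega), show (d + 3 - a) / 2 = 0 by omega,
      show (d + 3 - (d + 1 + 1)) / 2 = 0 by omega]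

theorem X_pow_dvd_gordonSum_sub_one {d a : ℕ} (ha : 1 ≤ a) (m : ℕ) :
    (X : ℤ⟦X⟧) ^ (2 * m) ∣ gordonSum d a m - 1 := by
  induction d generalizing m with
  | zero => simp [gordonSum, show a ≠ 0 by omega]
  | succ d ih =>
    have hs := hasSum_gordonSum d a m
    rw [← hs.tsum_eq, hs.summable.tsum_eq_zero_add]
    simp only [mul_zero, ne_eq, OfNat.ofNat_ne_zero, not_false_eq_true, zero_pow, add_zero,
      pow_zero, invQQPoch_zero, one_mul, zero_mul]
    rw [add_sub_right_comm]
    refine dvd_add (ih m) (X_pow_dvd_tsum _ (fun N => ?_) ?_)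
    · refine ((((pow_dvd_pow _ ?_).mul_right _).mul_right _).mul_right _)
      nlinarith [Nat.zero_le (m * N), Nat.zero_le (d * ((N + 1) ^ 2 + 2 * m * (N + 1)))]
    · exact (summable_nat_add_iff 1).2 hs.summable

/-- The shift of the innermost summation variable: because of the factor `1 - q^{2N}` the term
`N = 0` disappears, and the remaining ones may be renumbered. -/
theorem tsum_gordonSum_shift (d f a m : ℕ) :
    HasSum (fun N => (X : ℤ⟦X⟧) ^ ((d + 1) * (N ^ 2 + 2 * m * N)) * invQQPoch N *
        X ^ (2 * N * f) * ((1 - X ^ (2 * N)) * gordonSum d a (m + N)))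
      (∑' N, (X : ℤ⟦X⟧) ^ ((d + 1) * (N ^ 2 + 2 * m * N)) * invQQPoch N * X ^ (2 * N * f) *
        (X ^ ((d + 1) * (2 * N + 1 + 2 * m) + 2 * f) * gordonSum d a (m + N + 1))) := by
  have hs : Summable (fun N => (X : ℤ⟦X⟧) ^ ((d + 1) * (N ^ 2 + 2 * m * N)) * invQQPoch N *
        X ^ (2 * N * f) * ((1 - X ^ (2 * N)) * gordonSum d a (m + N))) :=
    summable_nat_of_X_pow_dvd fun N => gordonSum_term_dvd d _ m N _
  convert hs.hasSum using 1
  rw [hs.tsum_eq_zero_add]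
  simp only [mul_zero, pow_zero, sub_self, zero_mul, zero_add]
  refine tsum_congr fun N => ?_
  rw [← invQQPoch_succ_mul N]
  rw [show m + (N + 1) = m + N + 1 by ring]
  ring

/-- The functional equations of the multisum in the variable `x = q^{2m}`. With `a = b + 1`, the
first one is the case `a ≡ k`, and the second one the case `a ≢ k` modulo `2`. -/
theorem gordonSum_functional (d : ℕ) :
    (∀ b f m, d = b + 2 * f →
      (X : ℤ⟦X⟧) ^ (2 * m + 1) * (gordonSum d (b + 1) m - gordonSum d b m) =
        gordonSum d (b + 2) m - gordonSum d (b + 1) m +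
          X ^ (2 * m * (d + 1) + d + 1 + 2 * f) * gordonSum d (b + 1) (m + 1)) ∧
    (∀ b f m, d + 1 = b + 2 * f →
      (X : ℤ⟦X⟧) ^ (2 * m + 1) * (gordonSum d (b + 1) m - gordonSum d b m) =
        gordonSum d (b + 2) m - gordonSum d (b + 1) m) := by
  induction d with
  | zero =>
    constructor
    · intro b f m h
      obtain rfl : b = 0 := by omega
      obtain rfl : f = 0 := by omega
      simp [gordonSum]
    · intro b f m h
      obtain rfl : b = 1 := by omega
      simp [gordonSum]
  | succ d ih =>
    obtain ⟨ih1, ih2⟩ := ih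
    constructor
    · intro b f m h
      have e1 := hasSum_gordonSum d (b + 1) m
      have e0 := hasSum_gordonSum d b m
      have e2 := hasSum_gordonSum d (b + 2) m
      have e3 := hasSum_gordonSum d (b + 1) (m + 1)
      rw [show (d + 3 - (b + 1)) / 2 = f by omega] at e1 e3
      rw [show (d + 3 - b) / 2 = f + 1 by omega] at e0
      rw [show (d + 3 - (b + 2)) / 2 = f by omega] at e2
      have es := tsum_gordonSum_shift d f (b + 1) m
      have h1 := ((e1.sub e0).mul_left ((X : ℤ⟦X⟧) ^ (2 * m + 1))).sub
        ((e2.sub e1).add (es.mul_left ((X : ℤ⟦X⟧) ^ (2 * m + 1))))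
      have h2 := e3.mul_left ((X : ℤ⟦X⟧) ^ (2 * m * (d + 1 + 1) + (d + 1) + 1 + 2 * f))
      have h3 : ∀ N, (X : ℤ⟦X⟧) ^ (2 * m * (d + 1 + 1) + (d + 1) + 1 + 2 * f) *
          (X ^ ((d + 1) * (N ^ 2 + 2 * (m + 1) * N)) * invQQPoch N * X ^ (2 * N * f) *
            gordonSum d (b + 1) (m + 1 + N)) = X ^ (2 * m + 1) *
          (X ^ ((d + 1) * (N ^ 2 + 2 * m * N)) * invQQPoch N * X ^ (2 * N * f) *
            (X ^ ((d + 1) * (2 * N + 1 + 2 * m) + 2 * f) * gordonSum d (b + 1) (m + N + 1))) := by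
        intro N
        rw [show m + 1 + N = m + N + 1 by ring]
        ring
      have et := (summable_nat_of_X_pow_dvd fun N => gordonSum_term_dvd d (2 * N * f) m N
        (X ^ ((d + 1) * (2 * N + 1 + 2 * m) + 2 * f) * gordonSum d (b + 1) (m + N + 1))).hasSum
      simp only [h3] at h2
      have h4 := h2.unique (et.mul_left ((X : ℤ⟦X⟧) ^ (2 * m + 1)))
      rw [h4]
      -- the equation for `k - 1` cancels all terms except one with the factor `1 - q^{2N}`
      refine sub_eq_zero.1 (h1.unique ?_)
      convert hasSum_zero using 1
      funext N
      have hN := ih2 b f (m + N) (by omega)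
      rw [show 2 * (m + N) + 1 = 2 * m + 1 + 2 * N by ring, pow_add] at hN
      linear_combination (X ^ ((d + 1) * (N ^ 2 + 2 * m * N)) * invQQPoch N *
        X ^ (2 * N * f)) * hN
    · intro b f m h
      rcases f with _ | f
      · rw [gordonSum_of_lt (a := b) (by omega), gordonSum_of_lt (a := b + 1) (by omega),
          gordonSum_of_lt (a := b + 2) (by omega)]
        simp
      have e1 := hasSum_gordonSum d (b + 1) m
      have e0 := hasSum_gordonSum d b m
      have e2 := hasSum_gordonSum d (b + 2) m
      rw [show (d + 3 - (b + 1)) / 2 = f + 1 by omega] at e1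
      rw [show (d + 3 - b) / 2 = f + 1 by omega] at e0
      rw [show (d + 3 - (b + 2)) / 2 = f by omega] at e2
      have es := tsum_gordonSum_shift d f (b + 1) m
      have et := (summable_nat_of_X_pow_dvd fun N => gordonSum_term_dvd d (2 * N * f) m N
        (X ^ ((d + 1) * (2 * N + 1 + 2 * m) + 2 * f) * gordonSum d (b + 1) (m + N + 1))).hasSum
      have h1 := (((e1.sub e0).mul_left ((X : ℤ⟦X⟧) ^ (2 * m + 1))).sub (e2.sub e1)).add
        (es.sub et)
      rw [sub_self, add_zero] at h1
      -- the last term of the equation for `k - 1` cancels against the renumbered sum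
      refine sub_eq_zero.1 (h1.unique ?_)
      convert hasSum_zero using 1
      funext N
      have hN := ih1 b f (m + N) (by omega)
      have hE : 2 * (m + N) * (d + 1) + d + 1 + 2 * f =
        (d + 1) * (2 * N + 1 + 2 * m) + 2 * f := by ring
      rw [show 2 * (m + N) + 1 = 2 * m + 1 + 2 * N by ring, pow_add, hE] at hN
      linear_combination (X ^ ((d + 1) * (N ^ 2 + 2 * m * N)) * invQQPoch N *
        X ^ (2 * N * f)) * hN

/-- The generating function of the partitions into parts `> 2m + 1` of the kind considered here
in which the part `2m + 2` appears at most `c` times, expressed by multisums. -/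
noncomputable def gordonSumEven (d m : ℕ) : ℕ → ℤ⟦X⟧
  | 0 => gordonSum d (d + 1) (m + 1)
  | c + 1 => gordonSumEven d m c +
      if Even (c + 1) then X ^ ((2 * m + 2) * (c + 1)) * gordonSum d (d - c) (m + 1) else 0

/-- Allowing one more part `2m + 1` adds the partitions with exactly `b` of them, which leave room
for at most `e = k - 1 - b` parts `2m + 2`. -/
theorem gordonSum_succ {d b e : ℕ} (h : d = b + e) (m : ℕ) :
    gordonSum d (b + 1) m = gordonSum d b m + X ^ ((2 * m + 1) * b) * gordonSumEven d m e := by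
  have hX : (X : ℤ⟦X⟧) ^ (2 * m + 1) ≠ 0 := pow_ne_zero _ X_ne_zero
  induction e generalizing b with
  | zero =>
    have h1 := (gordonSum_functional d).1 b 0 m (by omega)
    obtain rfl : d = b := by omega
    rw [gordonSum_of_lt (a := d + 2) (by omega)] at h1
    apply mul_left_cancel₀ hX
    rw [gordonSumEven]
    linear_combination h1
  | succ e ih =>
    have h2 := ih (b := b + 1) (by omega)
    apply mul_left_cancel₀ hX
    rw [gordonSumEven, show d - e = b + 1 by omega]
    subst h
    split_ifs with he
    · obtain ⟨f, hf⟩ := he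
      have h1 := (gordonSum_functional (b + (e + 1))).1 b f m (by omega)
      rw [show 2 * f = e + 1 by omega] at h1
      linear_combination h1 + h2
    · obtain ⟨f, hf⟩ := Nat.not_even_iff_odd.1 he
      have h1 := (gordonSum_functional (b + (e + 1))).2 b (f + 1) m (by omega)
      linear_combination h1 + h2

/-! ### Generating functions of weighted sets -/

/-- The generating function `∑ q^{wt x}`, over `x ∈ S`, of a set with finitely many elements of each
weight. (Infinite fibres would contribute the junk value `0`.) -/
noncomputable def genFun {α : Type*} (S : Set α) (wt : α → ℕ) : ℤ⟦X⟧ :=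
  PowerSeries.mk fun n => (({x ∈ S | wt x = n} : Set α).ncard : ℤ)

theorem genFun_union {α : Type*} {S T : Set α} {wt : α → ℕ}
    (hS : ∀ n, {x ∈ S | wt x = n}.Finite) (hT : ∀ n, {x ∈ T | wt x = n}.Finite)
    (h : Disjoint S T) : genFun (S ∪ T) wt = genFun S wt + genFun T wt := by
  ext n
  simp only [genFun, coeff_mk, map_add]
  rw [← Nat.cast_add, ← Set.ncard_union_eq _ (hS n) (hT n)]
  · congr 2
    ext x
    simp only [Set.mem_ofPred_eq, Set.mem_union]
    tauto
  · exact h.mono (fun x hx => hx.1) (fun x hx => hx.1)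

theorem genFun_image {α β : Type*} {S : Set α} {wt : α → ℕ} {wt' : β → ℕ} {f : α → β} (c : ℕ)
    (hf : Set.InjOn f S) (hwt : ∀ x ∈ S, wt' (f x) = c + wt x) :
    genFun (f '' S) wt' = X ^ c * genFun S wt := by
  ext n
  rw [coeff_X_pow_mul']
  simp only [genFun, coeff_mk]
  split_ifs with hc
  · congr 1
    rw [← (hf.mono fun x hx => hx.1).ncard_image]
    congr 1
    ext y
    constructor
    · rintro ⟨⟨x, hx, rfl⟩, hy⟩
      exact ⟨x, ⟨hx, by have := hwt x hx; omega⟩, rfl⟩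
    · rintro ⟨x, ⟨hx, hxn⟩, rfl⟩
      exact ⟨⟨x, hx, rfl⟩, by have := hwt x hx; omega⟩
  · rw [Nat.cast_eq_zero]
    convert Set.ncard_empty β
    ext y
    simp only [Set.mem_ofPred_eq, Set.mem_empty_iff_false, iff_false]
    rintro ⟨⟨x, hx, rfl⟩, hy⟩
    have := hwt x hx
    omega

theorem X_pow_dvd_genFun {α : Type*} {S : Set α} {wt : α → ℕ} {w : ℕ} (h : ∀ x ∈ S, w ≤ wt x) :
    (X : ℤ⟦X⟧) ^ w ∣ genFun S wt := by
  rw [X_pow_dvd_iff]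
  intro n hn
  rw [genFun, coeff_mk, Nat.cast_eq_zero]
  convert Set.ncard_empty α
  ext x
  simp only [Set.mem_ofPred_eq, Set.mem_empty_iff_false, iff_false]
  rintro ⟨hx, hxn⟩
  have := h x hx
  omega

theorem X_pow_dvd_genFun_sub_one {α : Type*} {S : Set α} {wt : α → ℕ} {w : ℕ} (x₀ : α)
    (h₀ : x₀ ∈ S) (hwt : wt x₀ = 0) (h : ∀ x ∈ S, w ≤ wt x ∨ x = x₀) :
    (X : ℤ⟦X⟧) ^ w ∣ genFun S wt - 1 := by
  rw [X_pow_dvd_iff]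
  intro n hn
  rw [map_sub, genFun, coeff_mk, coeff_one, sub_eq_zero]
  split_ifs with h0
  · rw [Nat.cast_eq_one, Set.ncard_eq_one]
    refine ⟨x₀, ?_⟩
    ext x
    simp only [Set.mem_ofPred_eq, Set.mem_singleton_iff]
    constructor
    · rintro ⟨hx, hxn⟩
      exact (h x hx).resolve_left (by omega)
    · rintro rfl
      exact ⟨h₀, by omega⟩
  · rw [Nat.cast_eq_zero]
    convert Set.ncard_empty α
    ext x
    simp only [Set.mem_ofPred_eq, Set.mem_empty_iff_false, iff_false]
    rintro ⟨hx, hxn⟩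
    rcases h x hx with h1 | rfl <;> omega

/-! ### Gordon partitions by frequencies -/

/-- Multisets of parts `≥ s` in which `s` occurs at most `c` times, `j` and `j + 1` together occur
at most `d` times, and every even number occurs an even number of times. -/
def gordonSet (d s c : ℕ) : Set (Multiset ℕ) :=
  {M | (∀ x ∈ M, s ≤ x) ∧ M.count s ≤ c ∧ (∀ j, M.count j + M.count (j + 1) ≤ d) ∧
    ∀ j, Even j → Even (M.count j)}

theorem gordonSet_finite {d s c : ℕ} (hs : 1 ≤ s) (n : ℕ) :
    {M ∈ gordonSet d s c | M.sum = n}.Finite := by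
  refine (Set.finite_range fun p : n.Partition => p.parts).subset ?_
  rintro M ⟨hM, hn⟩
  exact ⟨⟨M, fun hx => lt_of_lt_of_le hs (hM.1 _ hx), hn⟩, rfl⟩

theorem gordonSet_zero (d s : ℕ) : gordonSet d s 0 = gordonSet d (s + 1) d := by
  ext M
  constructor
  · rintro ⟨h1, h2, h3, h4⟩
    refine ⟨fun x hx => ?_, ?_, h3, h4⟩
    · rcases (h1 x hx).eq_or_lt with rfl | h
      · have := Multiset.count_pos.2 hx
        omega
      · exact h
    · have := h3 s
      omega
  · rintro ⟨h1, h2, h3, h4⟩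
    refine ⟨fun x hx => by have := h1 x hx; omega, ?_, h3, h4⟩
    rw [Nat.le_zero, Multiset.count_eq_zero]
    intro hs
    have := h1 s hs
    omega

theorem gordonSet_succ_of_not {d s c : ℕ} (h : ¬(Odd s ∨ Even (c + 1))) :
    gordonSet d s (c + 1) = gordonSet d s c := by
  rw [not_or, Nat.not_odd_iff_even] at h
  ext M
  constructor
  · rintro ⟨h1, h2, h3, h4⟩
    refine ⟨h1, ?_, h3, h4⟩
    rcases h2.eq_or_lt with h5 | h5
    · exact absurd (h5 ▸ h4 s h.1) h.2
    · omega
  · rintro ⟨h1, h2, h3, h4⟩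
    exact ⟨h1, by omega, h3, h4⟩

theorem gordonSet_succ {d s c : ℕ} (hc : c + 1 ≤ d) (h : Odd s ∨ Even (c + 1)) :
    gordonSet d s (c + 1) = gordonSet d s c ∪
      (fun M => Multiset.replicate (c + 1) s + M) '' gordonSet d (s + 1) (d - (c + 1)) := by
  ext M
  constructor
  · rintro ⟨h1, h2, h3, h4⟩
    rcases h2.eq_or_lt with h5 | h5
    · right
      have hle : Multiset.replicate (c + 1) s ≤ M := Multiset.le_count_iff_replicate_le.1 h5.ge
      have hcnt : ∀ j, (M - Multiset.replicate (c + 1) s).count j =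
          if j = s then 0 else M.count j := by
        intro j
        rw [Multiset.count_sub, Multiset.count_replicate]
        by_cases hj : s = j
        · subst hj
          simp [h5]
        · simp [hj, Ne.symm hj]
      refine ⟨M - Multiset.replicate (c + 1) s, ⟨?_, ?_, ?_, ?_⟩, add_tsub_cancel_of_le hle⟩
      · intro x hx
        have hpos := Multiset.count_pos.2 hx
        rw [hcnt] at hpos
        split_ifs at hpos with hxs
        · omega
        · have := h1 x (Multiset.count_pos.1 hpos)
          omega
      · rw [hcnt]
        have := h3 s
        split_ifs <;> omega
      · intro j
        rw [hcnt, hcnt]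
        have := h3 j
        split_ifs <;> omega
      · intro j hj
        rw [hcnt]
        split_ifs
        · exact Even.zero
        · exact h4 j hj
    · exact Or.inl ⟨h1, by omega, h3, h4⟩
  · rintro (⟨h1, h2, h3, h4⟩ | ⟨M, ⟨h1, h2, h3, h4⟩, rfl⟩)
    · exact ⟨h1, by omega, h3, h4⟩
    · have h0 : M.count s = 0 := by
        rw [Multiset.count_eq_zero]
        intro hs
        have := h1 s hs
        omega
      have hcnt : ∀ j, (Multiset.replicate (c + 1) s + M).count j =
          if j = s then c + 1 else M.count j := by
        intro j
        rw [Multiset.count_add, Multiset.count_replicate]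
        by_cases hj : s = j
        · subst hj
          simp [h0]
        · simp [hj, Ne.symm hj]
      refine ⟨?_, ?_, ?_, ?_⟩
      · intro x hx
        rcases Multiset.mem_add.1 hx with hx | hx
        · rw [Multiset.eq_of_mem_replicate hx]
        · have := h1 x hx
          omega
      · simp only [hcnt]
        simp
      · intro j
        simp only [hcnt]
        have h3j := h3 j
        by_cases hj : j = s
        · subst hj
          simp only [if_true, Nat.succ_ne_self, if_false]
          omega
        · by_cases hj' : j + 1 = s
          · have : M.count j = 0 := by
              rw [Multiset.count_eq_zero]
              intro hs
              have := h1 j hs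
              omega
            simp only [hj, hj', if_true, if_false]
            omega
          · simpa only [hj, hj', if_false] using h3j
      · intro j hj
        simp only [hcnt]
        split_ifs with hjs
        · subst hjs
          exact h.resolve_left (Nat.not_odd_iff_even.2 hj)
        · exact h4 j hj

/-- The multisets with exactly `c + 1` parts `s` are obtained by adding these parts to multisets of
larger parts. -/
theorem genFun_gordonSet_succ {d s c : ℕ} (hs : 1 ≤ s) (hc : c + 1 ≤ d) :
    genFun (gordonSet d s (c + 1)) Multiset.sum = genFun (gordonSet d s c) Multiset.sum +
      if Odd s ∨ Even (c + 1) then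
        X ^ (s * (c + 1)) * genFun (gordonSet d (s + 1) (d - (c + 1))) Multiset.sum else 0 := by
  split_ifs with h
  · have hfin := fun n => gordonSet_finite (d := d) (c := c + 1) hs n
    rw [gordonSet_succ hc h] at hfin ⊢
    rw [genFun_union (gordonSet_finite hs)
      (fun n => (hfin n).subset fun x hx => ⟨Or.inr hx.1, hx.2⟩), genFun_image (s * (c + 1))]
    · exact fun x _ y _ hxy => add_left_cancel hxy
    · intro M _
      simp only [Multiset.sum_add, Multiset.sum_replicate, smul_eq_mul, mul_comm s]
    · rw [Set.disjoint_left]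
      rintro _ hM ⟨M, _, rfl⟩
      have := hM.2.1
      simp only [Multiset.count_add, Multiset.count_replicate_self] at this
      omega
  · rw [gordonSet_succ_of_not h, add_zero]

/-- The multisum form of the generating function of `gordonSet d s c`, for `s = 2m + 1` and for
`s = 2m + 2`. -/
noncomputable def gordonTarget (d s c : ℕ) : ℤ⟦X⟧ :=
  if Odd s then gordonSum d (c + 1) (s / 2) else gordonSumEven d (s / 2 - 1) c

theorem gordonTarget_zero {d s : ℕ} (hs : 1 ≤ s) :
    gordonTarget d s 0 = gordonTarget d (s + 1) d := by
  obtain ⟨r, rfl | rfl⟩ : ∃ r, s = 2 * r + 1 ∨ s = 2 * r + 2 := ⟨(s - 1) / 2, by omega⟩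
  · rw [gordonTarget, gordonTarget, if_pos (by simp), if_neg (by simp [parity_simps]),
      show (2 * r + 1) / 2 = r by omega, show (2 * r + 1 + 1) / 2 - 1 = r by omega,
      gordonSum_succ (b := 0) (e := d) (by omega), gordonSum_zero]
    simp
  · rw [gordonTarget, gordonTarget, if_neg (by simp [parity_simps]),
      if_pos (by simp [parity_simps]),
      show (2 * r + 2) / 2 - 1 = r by omega, show (2 * r + 2 + 1) / 2 = r + 1 by omega,
      gordonSumEven]

theorem gordonTarget_succ {d s c : ℕ} (hs : 1 ≤ s) (hc : c + 1 ≤ d) :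
    gordonTarget d s (c + 1) = gordonTarget d s c +
      if Odd s ∨ Even (c + 1) then X ^ (s * (c + 1)) * gordonTarget d (s + 1) (d - (c + 1))
        else 0 := by
  obtain ⟨r, rfl | rfl⟩ : ∃ r, s = 2 * r + 1 ∨ s = 2 * r + 2 := ⟨(s - 1) / 2, by omega⟩
  · have h1 : Odd (2 * r + 1) := by simp
    have h2 : ¬ Odd (2 * r + 1 + 1) := by simp [parity_simps]
    simp only [gordonTarget, h1, h2, if_true, if_false, true_or]
    rw [show (2 * r + 1) / 2 = r by omega, show (2 * r + 1 + 1) / 2 - 1 = r by omega,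
      gordonSum_succ (b := c + 1) (e := d - (c + 1)) (by omega)]
  · have h1 : ¬ Odd (2 * r + 2) := by simp [parity_simps]
    have h2 : Odd (2 * r + 2 + 1) := by simp [parity_simps]
    simp only [gordonTarget, h1, h2, if_true, if_false, false_or]
    rw [show (2 * r + 2) / 2 - 1 = r by omega, show (2 * r + 2 + 1) / 2 = r + 1 by omega,
      show d - (c + 1) + 1 = d - c by omega, gordonSumEven]

theorem X_pow_dvd_gordonTarget_sub_one (d m c : ℕ) :
    (X : ℤ⟦X⟧) ^ m ∣ gordonTarget d (m + 1) c - 1 := by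
  obtain ⟨r, rfl | rfl⟩ : ∃ r, m = 2 * r ∨ m = 2 * r + 1 := ⟨m / 2, by omega⟩
  · rw [gordonTarget, if_pos (by simp), show (2 * r + 1) / 2 = r by omega]
    exact X_pow_dvd_gordonSum_sub_one (by omega) r
  · rw [gordonTarget, if_neg (by simp [parity_simps]),
      show (2 * r + 1 + 1) / 2 - 1 = r by omega]
    induction c with
    | zero =>
      exact (pow_dvd_pow _ (by omega)).trans (X_pow_dvd_gordonSum_sub_one (by omega) (r + 1))
    | succ c ih =>
      rw [gordonSumEven, add_sub_right_comm]
      refine dvd_add ih ?_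
      split_ifs
      · exact (pow_dvd_pow _ (by nlinarith [Nat.zero_le (r * c)])).mul_right _
      · exact dvd_zero _

/-- Both sides obey the same recurrence in `s`, and tend to `1` as `s` grows. -/
theorem genFun_gordonSet_eq {d s c : ℕ} (hs : 1 ≤ s) (hc : c ≤ d) :
    genFun (gordonSet d s c) Multiset.sum = gordonTarget d s c := by
  have key := eq_zero_of_X_pow_dvd (ι := Fin (d + 1)) (D := fun m c =>
    genFun (gordonSet d (m + 1) c) Multiset.sum - gordonTarget d (m + 1) c) 0 ?_ ?_
    (s - 1) ⟨c, by omega⟩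
  · simpa [Nat.sub_add_cancel hs, sub_eq_zero] using key
  · intro m c
    have h1 : (X : ℤ⟦X⟧) ^ m ∣ genFun (gordonSet d (m + 1) c) Multiset.sum - 1 := by
      refine X_pow_dvd_genFun_sub_one 0 ⟨by simp, by simp, by simp, by simp⟩ (by simp) ?_
      intro M hM
      rcases M.empty_or_exists_mem with h0 | ⟨x, hx⟩
      · exact Or.inr h0
      · have := hM.1 x hx
        have := Multiset.le_sum_of_mem hx
        exact Or.inl (by omega)
    have := dvd_sub h1 (X_pow_dvd_gordonTarget_sub_one d m c)
    simpa using this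
  · rintro m N ih ⟨c, hc⟩
    induction c with
    | zero =>
      simpa [gordonSet_zero, gordonTarget_zero (show 1 ≤ m + 1 by omega)] using
        ih ⟨d, by omega⟩
    | succ c ihc =>
      have h1 := ihc (by omega)
      have h2 := ih ⟨d - (c + 1), by omega⟩
      simp only at h1 h2 ⊢
      rw [genFun_gordonSet_succ (by omega) (by omega), gordonTarget_succ (by omega) (by omega)]
      split_ifs
      · rw [add_sub_add_comm, ← mul_sub]
        exact dvd_add h1 (h2.mul_left _)
      · simpa using h1

/-- In a non-increasing list, the entries `≥ t` are the first ones. -/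
theorem le_getElem_iff_lt_countP {l : List ℕ} (hl : l.Pairwise (· ≥ ·)) (t i : ℕ)
    (hi : i < l.length) : t ≤ l[i] ↔ i < l.countP (t ≤ ·) := by
  induction l generalizing i with
  | nil => simp at hi
  | cons x l ih =>
    rw [List.pairwise_cons] at hl
    rw [List.countP_cons]
    cases i with
    | zero =>
      by_cases hx : t ≤ x
      · simp [hx]
      · have : l.countP (t ≤ ·) = 0 := by
          rw [List.countP_eq_zero]
          intro y hy
          have := hl.1 y hy
          simp only [decide_eq_true_eq]
          omega
        simp [hx, this]
    | succ i =>
      have hi' : i < l.length := by simpa using hi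
      rw [List.getElem_cons_succ, ih hl.2 i hi']
      by_cases hx : t ≤ x
      · simp [hx]
      · have : l.countP (t ≤ ·) = 0 := by
          rw [List.countP_eq_zero]
          intro y hy
          have := hl.1 y hy
          simp only [decide_eq_true_eq]
          omega
        simp [hx, this]

theorem countP_le_eq_count_add (l : List ℕ) (t : ℕ) :
    l.countP (t ≤ ·) = l.count t + l.countP (t + 1 ≤ ·) := by
  induction l with
  | nil => simp
  | cons x l ih =>
    rw [List.countP_cons, List.countP_cons, List.count_cons, ih]
    simp only [decide_eq_true_eq, beq_iff_eq]
    split_ifs <;> omega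

/-- The difference condition on the parts is a condition on frequencies. -/
theorem diff_condition_iff {l : List ℕ} (hl : l.Pairwise (· ≥ ·)) (d : ℕ) :
    (∀ (i : ℕ) (hi : i + d < l.length), l[i + d] + 2 ≤ l[i]) ↔
      ∀ j, l.count j + l.count (j + 1) ≤ d := by
  have e : ∀ j, l.countP (j ≤ ·) = l.count j + (l.count (j + 1) + l.countP (j + 2 ≤ ·)) :=
    fun j => by rw [countP_le_eq_count_add l j, countP_le_eq_count_add l (j + 1)]
  constructor
  · intro h j
    by_contra! hlt
    have h1 := e j
    have hlen : l.countP (j ≤ ·) ≤ l.length := List.countP_le_length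
    have hi : l.countP (j + 2 ≤ ·) + d < l.length := by omega
    have h2 := (le_getElem_iff_lt_countP hl j _ hi).2 (by omega)
    have h3 := (le_getElem_iff_lt_countP hl (j + 2) (l.countP (j + 2 ≤ ·)) (by omega)).1
      (by have := h _ hi; omega)
    omega
  · intro h i hi
    refine (le_getElem_iff_lt_countP hl _ i (by omega)).2 ?_
    have h1 := e l[i + d]
    have h2 := h l[i + d]
    have h3 := (le_getElem_iff_lt_countP hl l[i + d] (i + d) hi).1 le_rfl
    omega

theorem W_eq_coeff {d a n : ℕ} (ha : 1 ≤ a) (hak : a ≤ d + 1) :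
    (W (d + 1) a n : ℤ) = coeff n (gordonSum d a 0) := by
  have h := genFun_gordonSet_eq (d := d) (s := 1) (c := a - 1) le_rfl (by omega)
  rw [gordonTarget, if_pos (by simp), Nat.sub_add_cancel ha] at h
  change _ = gordonSum d a 0 at h
  have hW : W (d + 1) a n =
      {p : n.Partition | IsGordon (d + 1) a p ∧ EvenPartsEven p}.ncard := by
    rw [W, ← Nat.card_coe_set_eq]
    rfl
  rw [← h, genFun, coeff_mk, Nat.cast_inj, hW,
    ← Set.ncard_image_of_injective (f := fun p : n.Partition => p.parts) _
    (fun p p' h => Nat.Partition.ext h)]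
  congr 1
  have hcond : ∀ p : n.Partition, (IsGordon (d + 1) a p ∧ EvenPartsEven p) ↔
      p.parts ∈ gordonSet d 1 (a - 1) := by
    intro p
    have hcount : ∀ j, (sortedParts p).count j = p.parts.count j := by
      intro j
      rw [← Multiset.coe_count, sortedParts, Multiset.sort_eq]
    have hdiff := diff_condition_iff (l := sortedParts p) (Multiset.pairwise_sort ..) d
    simp only [hcount] at hdiff
    constructor
    · rintro ⟨⟨h1, h2⟩, h3⟩
      refine ⟨fun x hx => p.parts_pos hx, h2, hdiff.1 h1, fun j hj => ?_⟩
      by_cases hjp : j ∈ p.parts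
      · exact h3 j hjp hj
      · simp [Multiset.count_eq_zero.2 hjp]
    · rintro ⟨_, h2, h3, h4⟩
      exact ⟨⟨hdiff.2 h3, h2⟩, fun j _ hj => h4 j hj⟩
  ext M
  constructor
  · rintro ⟨p, hp, rfl⟩
    exact ⟨(hcond p).1 hp, p.parts_sum⟩
  · rintro ⟨hM, hn⟩
    exact ⟨⟨M, fun hx => hM.1 _ hx, hn⟩, (hcond _).2 hM, rfl⟩

/-! ### The multisum as a function of `N₁`, and its recurrences -/

/-- Convolution with the series `1 / (q²; q²)_m`. -/
noncomputable def pochConv (g : ℕ → ℤ⟦X⟧) (n : ℕ) : ℤ⟦X⟧ :=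
  ∑ M ∈ Finset.range (n + 1), invQQPoch (n - M) * g M

/-- A shorter convolution as one of full length: the factor `1 - q^{2(N+1-M)}` lowers the index of
`1 / (q²; q²)` and kills the last term. -/
theorem pochConv_eq_succ (g : ℕ → ℤ⟦X⟧) (N : ℕ) :
    pochConv g N = pochConv (fun M => (1 - X ^ (2 * (N + 1 - M))) * g M) (N + 1) := by
  rw [pochConv, pochConv, Finset.sum_range_succ _ (N + 1)]
  simp only [tsub_self, mul_zero, pow_zero, sub_self, zero_mul, add_zero]
  refine Finset.sum_congr rfl fun M hM => ?_
  have hM' := Finset.mem_range.1 hM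
  rw [show N + 1 - M = N - M + 1 by omega, ← mul_assoc, invQQPoch_succ_mul]

theorem pochConv_succ_of_sub {g h p : ℕ → ℤ⟦X⟧} {N : ℕ} (h0 : g 0 = h 0)
    (hs : ∀ M ≤ N, g (M + 1) = h (M + 1) - p M) :
    pochConv g (N + 1) = pochConv h (N + 1) - pochConv p N := by
  rw [pochConv, pochConv, pochConv, Finset.sum_range_succ', Finset.sum_range_succ' _ (N + 1), h0,
    add_sub_right_comm, ← Finset.sum_sub_distrib]
  congr 1
  refine Finset.sum_congr rfl fun M hM => ?_
  rw [hs M (by have := Finset.mem_range.1 hM; omega), Nat.add_sub_add_right]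
  ring

/-- `q^{N₁²} * innerSum d a N₁` is the part of the multisum for `k = d + 1` with given `N₁`. It is
built by summing over `N₂ = M`: the remaining sum is a multisum for `k - 1` with `a - 1` in place
of `a`, except that for `a = 1` the linear terms are `2 N₁ + 2 N₃ + ⋯`. -/
noncomputable def innerSum : ℕ → ℕ → ℕ → ℤ⟦X⟧
  | 0, _, n => if n = 0 then 1 else 0
  | d + 1, a, n => X ^ (if a = 1 then 2 * n else 0) *
      pochConv (fun M => X ^ (M ^ 2) * innerSum d (if a = 1 then 2 else a - 1) M) n

theorem innerSum_one (d n : ℕ) : innerSum (d + 1) 1 n =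
    X ^ (2 * n) * pochConv (fun M => X ^ (M ^ 2) * innerSum d 2 M) n := by
  simp [innerSum]

theorem innerSum_add_two (d a n : ℕ) : innerSum (d + 1) (a + 2) n =
    pochConv (fun M => X ^ (M ^ 2) * innerSum d (a + 1) M) n := by
  simp [innerSum]

theorem innerSum_zero_right (d a : ℕ) : innerSum d a 0 = 1 := by
  induction d generalizing a with
  | zero => simp [innerSum]
  | succ d ih => simp [innerSum, ih, pochConv, invQQPoch_zero]

theorem innerSum_of_lt {d a : ℕ} (h : d < a) (n : ℕ) : innerSum d a n = innerSum d (d + 1) n := by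
  induction d generalizing a n with
  | zero => simp [innerSum]
  | succ d ih =>
    obtain ⟨a, rfl⟩ : ∃ b, a = b + 2 := ⟨a - 2, by omega⟩
    rw [innerSum_add_two, innerSum_add_two]
    congr 1
    funext M
    rw [ih (by omega)]

theorem innerSum_rec_one (d n : ℕ) : innerSum d 1 n = X ^ (2 * n) * innerSum d 3 n := by
  cases d with
  | zero => rcases n with _ | n <;> simp [innerSum]
  | succ d => rw [innerSum_one, innerSum_add_two d 1]

theorem innerSum_rec_two (d N : ℕ) : innerSum (d + 1) 2 (N + 1) =
    X ^ (2 * N + 2) * innerSum (d + 1) 4 (N + 1) + innerSum (d + 1) 2 N := by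
  rw [innerSum_add_two d 0, innerSum_add_two d 2, innerSum_add_two d 0, pochConv_eq_succ _ N]
  simp only [pochConv, Finset.mul_sum, ← Finset.sum_add_distrib]
  refine Finset.sum_congr rfl fun M hM => ?_
  obtain ⟨u, hu⟩ := Nat.exists_eq_add_of_le (Nat.lt_succ_iff.1 (Finset.mem_range.1 hM))
  rw [zero_add, innerSum_rec_one, show 2 * N + 2 = 2 * (M + u) by omega, hu,
    Nat.add_sub_cancel_left]
  ring

/-- The recurrence in `a = b + 3` passes from `k - 1` to `k`: multiplied by `q^{2(N+1)}`, the one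
for `k - 1` can be convolved with `1 / (q²; q²)`, and what refers to `M - 1` there becomes a
convolution of length one less. For `a = 3` the recurrences for `a = 1` and `a = 2` take its place. -/
theorem innerSum_rec (d b N : ℕ) (hb : b + 2 ≤ d) :
    innerSum d (b + 3) (N + 1) * (1 + X ^ (4 * N + 4)) =
      X ^ (2 * N + 2) * (innerSum d (b + 5) (N + 1) + innerSum d (b + 1) (N + 1)) +
        (1 + X ^ (2 * N + 1)) * innerSum d (b + 3) N := by
  induction d generalizing b N with
  | zero => omega
  | succ d ih =>
    rcases b with _ | b
    · obtain ⟨d, rfl⟩ : ∃ e, d = e + 1 := ⟨d - 1, by omega⟩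
      simp only [zero_add]
      rw [innerSum_rec_one (d + 1 + 1), innerSum_add_two _ 1, innerSum_add_two _ 3,
        innerSum_add_two _ 1]
      simp only [Nat.reduceAdd]
      set B : ℕ → ℤ⟦X⟧ := fun M => X ^ (M ^ 2) * innerSum (d + 1) 2 M with hB
      have e1 : X ^ (2 * N + 2) * pochConv (fun M => X ^ (M ^ 2) * innerSum (d + 1) 4 M) (N + 1) =
          pochConv (fun M => X ^ (2 * (N + 1 - M)) * B M) (N + 1) -
            pochConv (fun M => X ^ (2 * N + 1) * B M) N := by
        rw [← pochConv_succ_of_sub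
          (g := fun M => X ^ (2 * N + 2) * (X ^ (M ^ 2) * innerSum (d + 1) 4 M))]
        · simp only [pochConv, Finset.mul_sum]
          exact Finset.sum_congr rfl fun M _ => by ring
        · simp only [hB, innerSum_zero_right]
          simp [mul_add]
        · intro M hM
          obtain ⟨u, rfl⟩ := Nat.exists_eq_add_of_le hM
          simp only [hB, innerSum_rec_two]
          rw [show M + u + 1 - (M + 1) = u by omega]
          ring
      have e2 : pochConv (fun M => X ^ (2 * N + 1) * B M) N = X ^ (2 * N + 1) * pochConv B N := by
        simp only [pochConv, Finset.mul_sum]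
        exact Finset.sum_congr rfl fun M _ => by ring
      have e3 : pochConv B N = pochConv B (N + 1) -
          pochConv (fun M => X ^ (2 * (N + 1 - M)) * B M) (N + 1) := by
        rw [pochConv_eq_succ]
        simp only [pochConv, ← Finset.sum_sub_distrib]
        exact Finset.sum_congr rfl fun M _ => by ring
      linear_combination -e1 + e2 - e3
    · have hR := fun M => ih b M (by omega)
      rw [innerSum_add_two _ (b + 2), innerSum_add_two _ (b + 4), innerSum_add_two _ b,
        innerSum_add_two _ (b + 2)]
      set B : ℕ → ℤ⟦X⟧ := fun M => X ^ (M ^ 2) * innerSum d (b + 3) M with hB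
      have e1 : X ^ (2 * N + 2) * (pochConv (fun M => X ^ (M ^ 2) * innerSum d (b + 5) M) (N + 1) +
          pochConv (fun M => X ^ (M ^ 2) * innerSum d (b + 1) M) (N + 1)) =
          pochConv (fun M => X ^ (2 * (N + 1 - M)) * (1 + X ^ (4 * M)) * B M) (N + 1) -
            pochConv (fun M => (X ^ (2 * N + 1) + X ^ (2 * (N + M) + 2)) * B M) N := by
        rw [← pochConv_succ_of_sub (g := fun M => X ^ (2 * N + 2) *
          (X ^ (M ^ 2) * (innerSum d (b + 5) M + innerSum d (b + 1) M)))]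
        · simp only [pochConv, mul_add, Finset.mul_sum, ← Finset.sum_add_distrib]
          exact Finset.sum_congr rfl fun M _ => by ring
        · simp only [hB, innerSum_zero_right]
          simp [mul_add]
        · intro M hM
          obtain ⟨u, rfl⟩ := Nat.exists_eq_add_of_le hM
          simp only [hB]
          rw [show M + u + 1 - (M + 1) = u by omega]
          linear_combination (-X ^ (2 * u) * X ^ ((M + 1) ^ 2)) * hR M
      have e2 : pochConv (fun M => (X ^ (2 * N + 1) + X ^ (2 * (N + M) + 2)) * B M) N =
          X ^ (2 * N + 1) * pochConv B N + pochConv (fun M => X ^ (2 * (N + M) + 2) * B M) N := by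
        simp only [pochConv, Finset.mul_sum, ← Finset.sum_add_distrib]
        exact Finset.sum_congr rfl fun M _ => by ring
      have e3 : pochConv (fun M => X ^ (2 * (N + M) + 2) * B M) N + pochConv B (N + 1) *
          (1 + X ^ (4 * N + 4)) = pochConv B N +
          pochConv (fun M => X ^ (2 * (N + 1 - M)) * (1 + X ^ (4 * M)) * B M) (N + 1) := by
        rw [pochConv_eq_succ, pochConv_eq_succ B N]
        simp only [pochConv, Finset.sum_mul, ← Finset.sum_add_distrib]
        refine Finset.sum_congr rfl fun M hM => ?_
        obtain ⟨u, hu⟩ := Nat.exists_eq_add_of_le (Nat.lt_succ_iff.1 (Finset.mem_range.1 hM))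
        rw [show 4 * N + 4 = 4 * (M + u) by omega, show 2 * (N + M) + 2 = 2 * (M + u + M) by omega,
          hu, Nat.add_sub_cancel_left]
        ring
      linear_combination -e1 + e2 + e3

/-- The multisum for `k = d + 1` with an additional factor `z^{N₁}` specialised at
`z = q^{2m}`. -/
noncomputable def pathSum (d a m : ℕ) : ℤ⟦X⟧ :=
  ∑' N, X ^ (2 * m * N + N ^ 2) * innerSum d a N

theorem pathSum_term_dvd (m N : ℕ) (g : ℤ⟦X⟧) : (X : ℤ⟦X⟧) ^ N ∣ X ^ (2 * m * N + N ^ 2) * g :=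
  (pow_dvd_pow _ ((Nat.le_self_pow two_ne_zero N).trans (Nat.le_add_left _ _))).mul_right _

theorem hasSum_pathSum (d a m : ℕ) :
    HasSum (fun N => (X : ℤ⟦X⟧) ^ (2 * m * N + N ^ 2) * innerSum d a N) (pathSum d a m) :=
  (summable_nat_of_X_pow_dvd fun N => pathSum_term_dvd m N _).hasSum

theorem pathSum_of_lt {d a : ℕ} (h : d < a) (m : ℕ) : pathSum d a m = pathSum d (d + 1) m := by
  simp only [pathSum, innerSum_of_lt h]

theorem X_pow_dvd_pathSum_sub_one (d a m : ℕ) : (X : ℤ⟦X⟧) ^ (2 * m) ∣ pathSum d a m - 1 := by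
  have hs := (hasSum_pathSum d a m).summable
  rw [pathSum, hs.tsum_eq_zero_add]
  simp only [mul_zero, ne_eq, OfNat.ofNat_ne_zero, not_false_eq_true, zero_pow, add_zero, pow_zero,
    innerSum_zero_right, mul_one, add_sub_cancel_left]
  refine X_pow_dvd_tsum _ (fun N => ?_) ((summable_nat_add_iff 1).2 hs)
  exact (pow_dvd_pow _ (by nlinarith [Nat.zero_le (m * N)])).mul_right _

/-- A power series in `z` is compared with `z` times another one by their coefficients. -/
theorem hasSum_eq_of_shift {f g : ℕ → ℤ⟦X⟧} {x y : ℤ⟦X⟧} (hf : HasSum f x) (hg : HasSum g y)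
    (h0 : f 0 = 0) (hs : ∀ N, f (N + 1) = g N) : x = y := by
  rw [← hf.tsum_eq, hf.summable.tsum_eq_zero_add, h0, zero_add, ← hg.tsum_eq]
  exact tsum_congr hs

theorem pathSum_rec_one (d m : ℕ) : pathSum d 1 m = pathSum d 3 (m + 1) := by
  refine tsum_congr fun N => ?_
  rw [innerSum_rec_one]
  ring

theorem pathSum_rec_two (d m : ℕ) : pathSum (d + 1) 2 m =
    pathSum (d + 1) 4 (m + 1) + X ^ (2 * m + 1) * pathSum (d + 1) 2 (m + 1) := by
  rw [← sub_eq_iff_eq_add']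
  refine hasSum_eq_of_shift ((hasSum_pathSum _ 2 m).sub (hasSum_pathSum _ 4 (m + 1)))
    ((hasSum_pathSum _ 2 (m + 1)).mul_left (X ^ (2 * m + 1))) ?_ fun N => ?_
  · simp [innerSum_zero_right]
  · rw [innerSum_rec_two]
    ring

theorem pathSum_rec (d b m : ℕ) (hb : b + 2 ≤ d) : pathSum d (b + 3) m =
    pathSum d (b + 5) (m + 1) + X ^ (2 * m + 1) * pathSum d (b + 3) (m + 1) +
      (pathSum d (b + 1) (m + 1) - (1 - X ^ (2 * m + 2)) * pathSum d (b + 3) (m + 2)) := by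
  have key : (pathSum d (b + 3) m + pathSum d (b + 3) (m + 2)) -
      (pathSum d (b + 5) (m + 1) + pathSum d (b + 1) (m + 1)) =
      X ^ (2 * m + 1) * pathSum d (b + 3) (m + 1) +
        X ^ (2 * m + 2) * pathSum d (b + 3) (m + 2) := by
    refine hasSum_eq_of_shift
      (((hasSum_pathSum d (b + 3) m).add (hasSum_pathSum d (b + 3) (m + 2))).sub
        ((hasSum_pathSum d (b + 5) (m + 1)).add (hasSum_pathSum d (b + 1) (m + 1))))
      (((hasSum_pathSum d (b + 3) (m + 1)).mul_left (X ^ (2 * m + 1))).add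
        ((hasSum_pathSum d (b + 3) (m + 2)).mul_left (X ^ (2 * m + 2)))) ?_ fun N => ?_
    · simp [innerSum_zero_right]
    · linear_combination (X ^ (2 * m * (N + 1) + (N + 1) ^ 2)) * innerSum_rec d b N hb
  linear_combination key

/-! ### Lattice paths whose ascents start at even weights -/

/-- `IsPathFrom k w u h l`: the steps `l`, started at the vertex of weight `w` and height `h < k`,
form the end of a lattice path below height `k`, ending with a South-East step or empty, in which
a run of North-East steps starts only at an even weight. The flag `u` says that the step before the
starting vertex is North-East. -/
def IsPathFrom (k : ℕ) : ℕ → Bool → ℕ → List Step → Prop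
  | _, u, h, [] => h = 0 ∧ u = false
  | w, u, h, Step.NE :: l => h + 1 < k ∧ (u = true ∨ Even w) ∧ IsPathFrom k (w + 1) true (h + 1) l
  | w, _, h, Step.SE :: l => 1 ≤ h ∧ IsPathFrom k (w + 1) false (h - 1) l
  | w, u, h, Step.E :: l => u = false ∧ h = 0 ∧ l ≠ [] ∧ IsPathFrom k (w + 1) false 0 l

/-- The sum of the weights of the peaks, for steps starting at weight `w`; `u` is as in
`IsPathFrom`. -/
def peakSum : ℕ → Bool → List Step → ℕ
  | _, _, [] => 0
  | w, _, Step.NE :: l => peakSum (w + 1) true l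
  | w, u, Step.SE :: l => (if u = true then w else 0) + peakSum (w + 1) false l
  | w, _, Step.E :: l => peakSum (w + 1) false l

/-- The step lists satisfying `IsPathFrom`. -/
def pathSet (k w : ℕ) (u : Bool) (h : ℕ) : Set (List Step) := {l | IsPathFrom k w u h l}

/-- A path is either a mere descent, or it has a peak. In the latter case the peaks have weights at
least `w`, and after the last peak there are fewer than `k` steps. -/
theorem IsPathFrom.peakSum_bounds {k w h : ℕ} {u : Bool} {l : List Step} (hk : h < k)
    (hl : IsPathFrom k w u h l) :
    (w ≤ peakSum w u l ∧ w + l.length ≤ peakSum w u l + k) ∨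
      (l = List.replicate h Step.SE ∧ u = false) := by
  induction l generalizing w h u with
  | nil =>
    obtain ⟨rfl, rfl⟩ := hl
    simp
  | cons s l ih =>
    rcases s with _ | _ | _
    · obtain ⟨h1, -, h3⟩ := hl
      rcases ih h1 h3 with ⟨h4, h5⟩ | h4
      · left
        simp only [peakSum, List.length_cons]
        omega
      · simp at h4
    · obtain ⟨h1, h2⟩ := hl
      rcases ih (by omega) h2 with ⟨h4, h5⟩ | ⟨h4, -⟩
      · left
        simp only [peakSum, List.length_cons]
        omega
      · cases u
        · right
          obtain ⟨h, rfl⟩ : ∃ j, h = j + 1 := ⟨h - 1, by omega⟩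
          simp [h4, List.replicate_succ]
        · left
          simp only [peakSum, List.length_cons, h4, List.length_replicate, if_true]
          omega
    · obtain ⟨-, rfl, h1, h2⟩ := hl
      rcases ih hk h2 with ⟨h4, h5⟩ | ⟨h4, -⟩
      · left
        simp only [peakSum, List.length_cons]
        omega
      · simp [h4] at h1

theorem isPathFrom_replicate (k w h : ℕ) :
    IsPathFrom k w false h (List.replicate h Step.SE) := by
  induction h generalizing w with
  | zero => simp [IsPathFrom]
  | succ h ih => simpa [List.replicate_succ, IsPathFrom] using ih (w + 1)

theorem peakSum_replicate (w h : ℕ) : peakSum w false (List.replicate h Step.SE) = 0 := by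
  induction h generalizing w with
  | zero => simp [peakSum]
  | succ h ih => simpa [List.replicate_succ, peakSum] using ih (w + 1)

theorem pathSet_finite {k w h : ℕ} {u : Bool} (hk : h < k) (n : ℕ) :
    {l ∈ pathSet k w u h | peakSum w u l = n}.Finite := by
  have : Finite Step := Finite.of_injective
    (fun s : Step => (decide (s = Step.NE), decide (s = Step.SE))) fun a b => by
      cases a <;> cases b <;> simp
  refine (List.finite_length_le Step (n + k + h)).subset ?_
  rintro l ⟨hl, hn⟩
  rcases IsPathFrom.peakSum_bounds hk hl with h1 | ⟨h1, -⟩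
  · show l.length ≤ _
    omega
  · show l.length ≤ _
    rw [h1, List.length_replicate]
    omega

/-- Prepend a South-East step at positive height, and an East step at height `0`, except that no
East step is added at the end of a path. -/
def addLower (h : ℕ) (l : List Step) : List Step :=
  if h = 0 then if l = [] then [] else Step.E :: l else Step.SE :: l

theorem addLower_zero_eq_cons {s : Step} {l l' : List Step} :
    addLower 0 l' = s :: l ↔ s = Step.E ∧ l ≠ [] ∧ l' = l := by
  rw [addLower, if_pos rfl]
  split_ifs with h0
  · simp only [false_iff]
    rintro ⟨-, h1, rfl⟩
    exact h1 h0
  · simp only [List.cons.injEq]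
    constructor
    · rintro ⟨rfl, rfl⟩
      exact ⟨rfl, h0, rfl⟩
    · rintro ⟨rfl, -, rfl⟩
      exact ⟨rfl, rfl⟩

theorem addLower_injective (h : ℕ) : Function.Injective (addLower h) := by
  intro l l' hl
  unfold addLower at hl
  split_ifs at hl <;> simp_all

theorem peakSum_addLower (w h : ℕ) (l : List Step) :
    peakSum w false (addLower h l) = peakSum (w + 1) false l := by
  unfold addLower
  split_ifs with h1 h2
  · simp [h2, peakSum]
  · simp [peakSum]
  · simp [peakSum]

/-- The decomposition by the first step, which is not East at positive height. -/
theorem pathSet_true {k w h : ℕ} (hh : 1 ≤ h) : pathSet k w true h =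
    (List.cons Step.SE '' pathSet k (w + 1) false (h - 1)) ∪
      (List.cons Step.NE '' if h + 1 < k then pathSet k (w + 1) true (h + 1) else ∅) := by
  ext l
  rcases l with _ | ⟨s, l⟩
  · simp [pathSet, IsPathFrom]
  · cases s <;> by_cases hk : h + 1 < k <;> simp [pathSet, IsPathFrom, hk, hh]

/-- The decomposition by the first step, where the empty path at height `0` is regarded as
followed by East steps. -/
theorem pathSet_false {k w h : ℕ} : pathSet k w false h =
    (addLower h '' pathSet k (w + 1) false (h - 1)) ∪
      (List.cons Step.NE ''
        if Even w ∧ h + 1 < k then pathSet k (w + 1) true (h + 1) else ∅) := by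
  ext l
  rcases l with _ | ⟨s, l⟩
  · rcases h with _ | h <;> simp [pathSet, addLower, IsPathFrom]
  · rcases h with _ | h
    · cases s <;> by_cases hk : 1 < k <;> by_cases hw : Even w <;>
        simp [pathSet, IsPathFrom, hk, hw, addLower_zero_eq_cons] <;> exact and_comm
    · cases s <;> by_cases hk : h + 1 + 1 < k <;> by_cases hw : Even w <;>
        simp [pathSet, IsPathFrom, hk, hw, addLower]

theorem genFun_cons_NE {k w h : ℕ} (u : Bool) (p : Prop) [Decidable p] :
    genFun (List.cons Step.NE '' if p then pathSet k (w + 1) true (h + 1) else ∅) (peakSum w u) =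
      if p then genFun (pathSet k (w + 1) true (h + 1)) (peakSum (w + 1) true) else 0 := by
  rw [genFun_image (wt := peakSum (w + 1) true) 0 (List.cons_injective.injOn)]
  · split_ifs
    · simp
    · ext n
      simp [genFun]
  · intro l _
    simp [peakSum]

theorem genFun_pathSet_true {k w h : ℕ} (hh : 1 ≤ h) (hk : h < k) :
    genFun (pathSet k w true h) (peakSum w true) =
      X ^ w * genFun (pathSet k (w + 1) false (h - 1)) (peakSum (w + 1) false) +
        if h + 1 < k then genFun (pathSet k (w + 1) true (h + 1)) (peakSum (w + 1) true)
          else 0 := by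
  have hfin := fun n => pathSet_finite (w := w) (u := true) hk n
  rw [pathSet_true hh] at hfin ⊢
  rw [genFun_union (fun n => (hfin n).subset fun x hx => ⟨Or.inl hx.1, hx.2⟩)
    (fun n => (hfin n).subset fun x hx => ⟨Or.inr hx.1, hx.2⟩), genFun_cons_NE,
    genFun_image (wt := peakSum (w + 1) false) w (List.cons_injective.injOn)]
  · intro l _
    simp [peakSum]
  · rw [Set.disjoint_left]
    rintro _ ⟨l, _, rfl⟩ ⟨l', _, h'⟩
    simp at h'

theorem genFun_pathSet_false {k w h : ℕ} (hk : h < k) :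
    genFun (pathSet k w false h) (peakSum w false) =
      genFun (pathSet k (w + 1) false (h - 1)) (peakSum (w + 1) false) +
        if Even w ∧ h + 1 < k then
          genFun (pathSet k (w + 1) true (h + 1)) (peakSum (w + 1) true) else 0 := by
  have hfin := fun n => pathSet_finite (w := w) (u := false) hk n
  rw [pathSet_false] at hfin ⊢
  rw [genFun_union (fun n => (hfin n).subset fun x hx => ⟨Or.inl hx.1, hx.2⟩)
    (fun n => (hfin n).subset fun x hx => ⟨Or.inr hx.1, hx.2⟩), genFun_cons_NE,
    genFun_image (wt := peakSum (w + 1) false) 0 (addLower_injective h).injOn, pow_zero, one_mul]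
  · intro l _
    rw [peakSum_addLower, zero_add]
  · rw [Set.disjoint_left]
    rintro _ ⟨l, _, rfl⟩ ⟨l', _, h'⟩
    unfold addLower at h'
    split_ifs at h' <;> simp at h'

/-- The multisum form of the generating function of the paths which start at weight `w` and height
`h`, the step before not being North-East. From an odd weight no ascent can start, so the path goes
down to height `h - 1` (or stays at height `0`, whence the truncated subtraction) at the next even
weight. -/
noncomputable def levelTarget (d w h : ℕ) : ℤ⟦X⟧ :=
  if Even w then pathSum d (d + 1 - h) (w / 2) else pathSum d (d + 1 - (h - 1)) ((w + 1) / 2)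

/-- The multisum form of the generating function of the paths which start at weight `w` and height
`h ≥ 1`, the step before being North-East. For even `w`, such a path differs from a path counted by
`levelTarget` only when it starts with a South-East step, and then by the factor `q^w` of the peak
at `w`. -/
noncomputable def ascentTarget (d w h : ℕ) : ℤ⟦X⟧ :=
  if Even w then
    pathSum d (d + 1 - h) (w / 2) - (1 - X ^ w) * pathSum d (d + 1 - h + 2) (w / 2 + 1)
  else X ^ w * levelTarget d (w + 1) (h - 1) +
    if h < d then pathSum d (d - h) ((w + 1) / 2) -
      (1 - X ^ (w + 1)) * pathSum d (d - h + 2) ((w + 1) / 2 + 1) else 0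

/-- Since `pathSum d a m` is constant for `a > d`, the formula also holds where `h - 1` and `h - 2`
are truncated. -/
theorem levelTarget_odd {d h : ℕ} (m : ℕ) (hd : h ≤ d) :
    levelTarget d (2 * m + 1) (h - 1) = pathSum d (d + 1 - h + 2) (m + 1) := by
  rw [levelTarget, if_neg (by simp), show (2 * m + 1 + 1) / 2 = m + 1 by omega]
  rcases h with _ | _ | h
  · rw [pathSum_of_lt (by omega), pathSum_of_lt (a := d + 1 - 0 + 2) (by omega)]
  · rw [pathSum_of_lt (by omega), pathSum_of_lt (a := d + 1 - (0 + 1) + 2) (by omega)]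
  · congr 1
    omega

theorem levelTarget_even (d m h : ℕ) : levelTarget d (2 * m) h = pathSum d (d + 1 - h) m := by
  rw [levelTarget, if_pos (by simp), show 2 * m / 2 = m by omega]

theorem levelTarget_rec {d w h : ℕ} (hd : h ≤ d) : levelTarget d w h =
    levelTarget d (w + 1) (h - 1) +
      if Even w ∧ h + 1 < d + 1 then ascentTarget d (w + 1) (h + 1) else 0 := by
  obtain ⟨m, rfl | rfl⟩ : ∃ m, w = 2 * m ∨ w = 2 * m + 1 := ⟨w / 2, by omega⟩
  · rw [levelTarget_odd m hd, levelTarget_even]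
    have he : Even (2 * m) := by simp
    have ho : ¬ Even (2 * m + 1) := by simp
    simp only [he, true_and, ascentTarget, ho, if_false]
    split_ifs with h1 h2
    · obtain ⟨b, hb⟩ : ∃ b, d = h + b + 2 := ⟨d - h - 2, by omega⟩
      rw [show d + 1 - h = b + 3 by omega, show d - (h + 1) = b + 1 by omega,
        show (2 * m + 1 + 1) / 2 = m + 1 by omega, show 2 * m + 1 + 1 = 2 * (m + 1) by ring,
        levelTarget_even, show d + 1 - (h + 1 - 1) = b + 3 by omega,
        pathSum_rec d b m (by omega), add_assoc]
      rfl
    · obtain ⟨e, rfl⟩ : ∃ e, d = e + 1 := ⟨d - 1, by omega⟩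
      rw [show e + 1 + 1 - h = 2 by omega, show 2 * m + 1 + 1 = 2 * (m + 1) by ring,
        levelTarget_even, show e + 1 + 1 - (h + 1 - 1) = 2 by omega, pathSum_rec_two, add_zero]
    · rw [show d + 1 - h = 1 by omega, pathSum_rec_one, add_zero]
  · have ho : ¬ Even (2 * m + 1) := by simp
    simp only [ho, false_and, if_false, add_zero]
    rw [show 2 * m + 1 + 1 = 2 * (m + 1) by ring, levelTarget_even, levelTarget, if_neg ho]
    congr 1
    omega

theorem ascentTarget_rec {d w h : ℕ} (hd : h ≤ d) : ascentTarget d w h =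
    X ^ w * levelTarget d (w + 1) (h - 1) +
      if h + 1 < d + 1 then ascentTarget d (w + 1) (h + 1) else 0 := by
  obtain ⟨m, rfl | rfl⟩ : ∃ m, w = 2 * m ∨ w = 2 * m + 1 := ⟨w / 2, by omega⟩
  · have he : Even (2 * m) := by simp
    have h1 := levelTarget_rec (w := 2 * m) hd
    simp only [he, true_and] at h1
    rw [levelTarget_even, levelTarget_odd m hd] at h1
    rw [levelTarget_odd m hd, ascentTarget, if_pos he, show 2 * m / 2 = m by omega, h1]
    ring
  · have ho : ¬ Even (2 * m + 1) := by simp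
    have he : Even (2 * m + 1 + 1) := by simp [parity_simps]
    rw [ascentTarget, if_neg ho, ascentTarget, if_pos he, show d + 1 - (h + 1) = d - h by omega]
    simp only [Nat.add_lt_add_iff_right]

theorem X_pow_dvd_levelTarget_sub_one (d w h : ℕ) :
    (X : ℤ⟦X⟧) ^ w ∣ levelTarget d w h - 1 := by
  rw [levelTarget]
  split_ifs with he
  · obtain ⟨m, rfl⟩ := he
    exact (pow_dvd_pow _ (by omega)).trans (X_pow_dvd_pathSum_sub_one d _ _)
  · obtain ⟨m, rfl⟩ := Nat.not_even_iff_odd.1 he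
    exact (pow_dvd_pow _ (by omega)).trans (X_pow_dvd_pathSum_sub_one d _ _)

theorem X_pow_dvd_ascentTarget (d w h : ℕ) : (X : ℤ⟦X⟧) ^ w ∣ ascentTarget d w h := by
  have key : ∀ m a b, (X : ℤ⟦X⟧) ^ (2 * m) ∣
      pathSum d a m - (1 - X ^ (2 * m)) * pathSum d b (m + 1) := by
    intro m a b
    have h1 := X_pow_dvd_pathSum_sub_one d a m
    have h2 := (pow_dvd_pow _ (show 2 * m ≤ 2 * (m + 1) by omega)).trans
      (X_pow_dvd_pathSum_sub_one d b (m + 1))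
    have h3 := dvd_mul_right ((X : ℤ⟦X⟧) ^ (2 * m)) (pathSum d b (m + 1))
    convert dvd_add (dvd_sub h1 h2) h3 using 1
    ring
  obtain ⟨m, rfl | rfl⟩ : ∃ m, w = 2 * m ∨ w = 2 * m + 1 := ⟨w / 2, by omega⟩
  · rw [ascentTarget, if_pos (by simp), show 2 * m / 2 = m by omega]
    exact key _ _ _
  · rw [ascentTarget, if_neg (by simp)]
    refine dvd_add (dvd_mul_right _ _) ?_
    split_ifs
    · rw [show 2 * m + 1 + 1 = 2 * (m + 1) by ring, show 2 * (m + 1) / 2 = m + 1 by omega]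
      exact (pow_dvd_pow _ (by omega)).trans (key _ _ _)
    · exact dvd_zero _

/-- Both sides obey the same recurrence in the starting weight, jointly for the two directions of
the step before, and have the same limit as the weight grows. -/
theorem genFun_pathSet_eq {d h : ℕ} (hd : h ≤ d) :
    genFun (pathSet (d + 1) 0 false h) (peakSum 0 false) = pathSum d (d + 1 - h) 0 := by
  have key := eq_zero_of_X_pow_dvd
    (ι := {p : Bool × ℕ // p.2 ≤ d ∧ (p.1 = true → 1 ≤ p.2)})
    (D := fun w p => genFun (pathSet (d + 1) w p.1.1 p.1.2) (peakSum w p.1.1) -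
      if p.1.1 = true then ascentTarget d w p.1.2 else levelTarget d w p.1.2) 0 ?_ ?_ 0
    ⟨(false, h), hd, by simp⟩
  · simpa [sub_eq_zero, levelTarget] using key
  · rintro w ⟨⟨u, h⟩, hd, hu⟩
    simp only at hd hu
    cases u
    · have h1 : (X : ℤ⟦X⟧) ^ w ∣
          genFun (pathSet (d + 1) w false h) (peakSum w false) - 1 :=
        X_pow_dvd_genFun_sub_one _ (isPathFrom_replicate _ _ h) (peakSum_replicate w h)
          fun l hl => (IsPathFrom.peakSum_bounds (Nat.lt_succ_of_le hd) hl).imp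
            (fun h => h.1) (fun h => h.1)
      simpa using dvd_sub h1 (X_pow_dvd_levelTarget_sub_one d w h)
    · have h1 : (X : ℤ⟦X⟧) ^ w ∣ genFun (pathSet (d + 1) w true h) (peakSum w true) :=
        X_pow_dvd_genFun fun l hl =>
          ((IsPathFrom.peakSum_bounds (Nat.lt_succ_of_le hd) hl).resolve_right (by simp)).1
      simpa using dvd_sub h1 (X_pow_dvd_ascentTarget d w h)
  · rintro w N ih ⟨⟨u, h⟩, hd, hu⟩
    simp only at hd hu
    have h1 := ih ⟨(false, h - 1), by simp only; omega, by simp⟩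
    simp only [Bool.false_eq_true, if_false] at h1
    have h2 : h + 1 < d + 1 → (X : ℤ⟦X⟧) ^ N ∣
        genFun (pathSet (d + 1) (w + 1) true (h + 1)) (peakSum (w + 1) true) -
          ascentTarget d (w + 1) (h + 1) := fun hlt => by
      simpa using ih ⟨(true, h + 1), by simp only; omega, by simp⟩
    cases u
    · simp only [Bool.false_eq_true, if_false]
      rw [genFun_pathSet_false (by omega), levelTarget_rec hd]
      split_ifs with hc
      · rw [add_sub_add_comm]
        exact dvd_add h1 (h2 hc.2)
      · simpa using h1
    · simp only [if_true]
      rw [genFun_pathSet_true (hu rfl) (by omega), ascentTarget_rec hd]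
      split_ifs with hc
      · rw [add_sub_add_comm, ← mul_sub]
        exact dvd_add (h1.mul_left _) (h2 hc)
      · rw [add_zero, add_zero, ← mul_sub]
        exact h1.mul_left _

/-! ### The parity condition is local -/

namespace LatticePath

variable {L : LatticePath}

theorem height_nonneg' {x : ℕ} (hx : x ≤ L.steps.length) : 0 ≤ L.height x := L.height_nonneg x hx

theorem step_cases {x : ℕ} (hx : x < L.steps.length) :
    (L.steps[x]? = some Step.NE ∧ L.height (x + 1) = L.height x + 1) ∨
    (L.steps[x]? = some Step.SE ∧ L.height (x + 1) = L.height x - 1) ∨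
    (L.steps[x]? = some Step.E ∧ L.height x = 0 ∧ L.height (x + 1) = 0) := by
  have h := List.getElem?_eq_getElem hx
  have h1 := L.height_succ h
  rcases hs : L.steps[x] with _ | _ | _ <;> rw [hs] at h h1 <;> simp only [Step.rise] at h1
  · exact Or.inl ⟨h, h1⟩
  · exact Or.inr (Or.inl ⟨h, by omega⟩)
  · have h2 := L.east_height x h
    change L.height x = 0 at h2
    exact Or.inr (Or.inr ⟨h, h2, by omega⟩)

theorem IsPeak.lt_length {x : ℕ} (hx : L.IsPeak x) : x < L.steps.length :=
  (List.getElem?_eq_some_iff.1 hx.2.2).1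

theorem IsPeak.height_pred {x : ℕ} (hx : L.IsPeak x) : L.height (x - 1) = L.height x - 1 := by
  have h := L.height_succ hx.2.1
  rw [Nat.sub_add_cancel hx.1] at h
  simp only [Step.rise] at h
  omega

theorem IsPeak.height_succ {x : ℕ} (hx : L.IsPeak x) : L.height (x + 1) = L.height x - 1 := by
  have h := L.height_succ hx.2.2
  simp only [Step.rise] at h
  omega

/-- Descending from `a` to `b`, there is a first vertex of height `m`. -/
theorem exists_first_height_eq {a b : ℕ} {m : ℤ} (hab : a ≤ b) (hb : b ≤ L.steps.length)
    (ha : m ≤ L.height a) (hm : L.height b ≤ m) :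
    ∃ c, a ≤ c ∧ c ≤ b ∧ L.height c = m ∧ ∀ z, a ≤ z → z < c → m < L.height z := by
  obtain ⟨n, rfl⟩ := Nat.exists_eq_add_of_le hab
  induction n generalizing a with
  | zero => exact ⟨a, le_rfl, hab, le_antisymm hm ha, fun z h1 h2 => by omega⟩
  | succ n ih =>
    rcases ha.eq_or_lt with h | h
    · exact ⟨a, le_rfl, hab, h.symm, fun z h1 h2 => by omega⟩
    · have h1 : m ≤ L.height (a + 1) := by
        rcases step_cases (L := L) (x := a) (by omega) with h2 | h2 | h2 <;> omega
      obtain ⟨c, h2, h3, h4, h5⟩ := ih (a := a + 1) h1 (by omega) (by omega)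
        (by rwa [show a + 1 + n = a + (n + 1) by ring])
      refine ⟨c, by omega, by omega, h4, fun z h6 h7 => ?_⟩
      rcases h6.eq_or_lt with rfl | h6
      · exact h
      · exact h5 z h6 h7

/-- Ascending from `a` to `b`, there is a last vertex of height `m`. -/
theorem exists_last_height_eq {a b : ℕ} {m : ℤ} (hab : a ≤ b) (hb : b ≤ L.steps.length)
    (ha : L.height a ≤ m) (hm : m ≤ L.height b) :
    ∃ c, a ≤ c ∧ c ≤ b ∧ L.height c = m ∧ ∀ z, c < z → z ≤ b → m < L.height z := by
  induction b, hab using Nat.le_induction with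
  | base => exact ⟨a, le_rfl, le_rfl, le_antisymm ha hm, fun z h1 h2 => by omega⟩
  | succ b hab ih =>
    rcases hm.eq_or_lt with h | h
    · exact ⟨b + 1, by omega, le_rfl, h.symm, fun z h1 h2 => by omega⟩
    · have h1 : m ≤ L.height b := by
        rcases step_cases (L := L) (x := b) (by omega) with h2 | h2 | h2 <;> omega
      obtain ⟨c, h2, h3, h4, h5⟩ := ih (by omega) h1
      refine ⟨c, h2, by omega, h4, fun z h6 h7 => ?_⟩
      rcases h7.eq_or_lt with rfl | h7
      · exact h
      · exact h5 z h6 (by omega)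

/-- Without East steps, heights change parity at each step. -/
theorem even_height_sub {a b : ℕ} (hab : a ≤ b) (hb : b ≤ L.steps.length)
    (hE : ∀ i, a ≤ i → i < b → L.steps[i]? ≠ some Step.E) :
    Even (L.height b - L.height a - ((b : ℤ) - a)) := by
  induction b, hab using Nat.le_induction with
  | base => simp
  | succ b hab ih =>
    have h := ih (by omega) fun i h1 h2 => hE i h1 (by omega)
    rw [Int.even_iff] at h ⊢
    rcases step_cases (L := L) (x := b) (by omega) with h2 | h2 | h2
    · push_cast
      omega
    · push_cast
      omega
    · exact absurd h2.1 (hE b hab (by omega))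

theorem steps_ne_E_of_pos {i : ℕ} (hi : 0 < L.height i) : L.steps[i]? ≠ some Step.E := by
  intro h
  have := L.east_height i h
  change L.height i = 0 at this
  omega

/-- A mountain has a leftmost highest peak. -/
theorem exists_isPeak_max {a b : ℕ} {m : ℤ} (hab : a + 1 < b) (hb : b ≤ L.steps.length)
    (ha : L.height a = m) (hbm : L.height b = m) (hm : ∀ z, a < z → z < b → m < L.height z) :
    ∃ x, a < x ∧ x < b ∧ L.IsPeak x ∧ (∀ z, a ≤ z → z ≤ b → L.height z ≤ L.height x) ∧
      ∀ z, a ≤ z → z < x → L.height z < L.height x := by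
  classical
  have hex : ∃ x, a ≤ x ∧ x ≤ b ∧ ∀ z, a ≤ z → z ≤ b → L.height z ≤ L.height x := by
    obtain ⟨x, hx, hmax⟩ := Finset.exists_max_image (Finset.Icc a b) L.height ⟨a, by simp; omega⟩
    rw [Finset.mem_Icc] at hx
    exact ⟨x, hx.1, hx.2, fun z h1 h2 => hmax z (Finset.mem_Icc.2 ⟨h1, h2⟩)⟩
  obtain ⟨h1, h2, h3⟩ := Nat.find_spec hex
  have hmin : ∀ z, z < Nat.find hex → ¬ _ := fun z hz => Nat.find_min hex hz
  generalize Nat.find hex = x at h1 h2 h3 hmin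
  have h0 := height_nonneg' (L := L) (x := a) (by omega)
  have h4 := hm (a + 1) (by omega) hab
  have h5 := h3 (a + 1) (by omega) (by omega)
  have h6 : a < x := by
    rcases h1.eq_or_lt with rfl | h
    · omega
    · exact h
  have h7 : x < b := by
    rcases h2.eq_or_lt with rfl | h
    · omega
    · exact h
  have h8 : ∀ z, a ≤ z → z < x → L.height z < L.height x := by
    intro z hz1 hz2
    by_contra! hlt
    exact hmin z hz2 ⟨hz1, by omega, fun y hy1 hy2 => (h3 y hy1 hy2).trans hlt⟩
  refine ⟨x, h6, h7, ⟨by omega, ?_, ?_⟩, h3, h8⟩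
  · have h9 := h8 (x - 1) (by omega) (by omega)
    have h10 := step_cases (L := L) (x := x - 1) (by omega)
    rw [Nat.sub_add_cancel (by omega)] at h10
    rcases h10 with h | h | h
    · exact h.1
    · omega
    · omega
  · have h9 := h3 (x + 1) (by omega) (by omega)
    rcases step_cases (L := L) (x := x) (by omega) with h | h | h
    · omega
    · exact h.1
    · omega

variable (L) in
/-- Height `m` is reached to the left of `x` before a peak at least as high as `x`. -/
def LeftReach (x : ℕ) (m : ℤ) : Prop :=
  ∃ x₁ < x, L.height x₁ = m ∧ ∀ z, x₁ < z → z < x → L.IsPeak z → L.height z < L.height x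

variable (L) in
/-- Height `m` is reached to the right of `x` before a peak higher than `x`. -/
def RightReach (x : ℕ) (m : ℤ) : Prop :=
  ∃ x₂, x < x₂ ∧ x₂ ≤ L.steps.length ∧ L.height x₂ = m ∧
    ∀ z, x < z → z < x₂ → L.IsPeak z → L.height z ≤ L.height x

theorem mem_relHeightSet_iff {x : ℕ} {h : ℤ} : h ∈ L.relHeightSet x ↔
    LeftReach L x (L.height x - h) ∧ RightReach L x (L.height x - h) := by
  constructor
  · rintro ⟨x₁, x₂, h1, h2, h3, h4, h5, h6⟩
    refine ⟨⟨x₁, h1, h4, fun z hz1 hz2 hz => ?_⟩, ⟨x₂, h2, h3, h5, fun z hz1 hz2 hz => ?_⟩⟩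
    · obtain ⟨h7, h8⟩ := h6 z hz1 (by omega) hz
      by_contra! hlt
      have := h8 (le_antisymm h7 hlt)
      omega
    · exact (h6 z (by omega) hz2 hz).1
  · rintro ⟨⟨x₁, h1, h2, h3⟩, ⟨x₂, h4, h5, h6, h7⟩⟩
    refine ⟨x₁, x₂, h1, h4, h5, h2, h6, fun z hz1 hz2 hz => ?_⟩
    rcases lt_trichotomy z x with hzx | rfl | hzx
    · have := h3 z hz1 hzx hz
      exact ⟨this.le, fun h => by omega⟩
    · exact ⟨le_rfl, fun _ => le_rfl⟩
    · exact ⟨h7 z hzx hz2 hz, fun _ => hzx.le⟩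

theorem relHeight_eq {x : ℕ} {m : ℤ} (hx : L.IsPeak x) (h1 : LeftReach L x m)
    (h2 : RightReach L x m) (h3 : ∀ m' < m, ¬(LeftReach L x m' ∧ RightReach L x m')) :
    L.relHeight x = L.height x - m := by
  refine (L.isGreatest_relHeight hx).unique ⟨?_, ?_⟩
  · rw [mem_relHeightSet_iff, sub_sub_cancel]
    exact ⟨h1, h2⟩
  · intro h hh
    by_contra! hlt
    exact h3 _ (by omega) (mem_relHeightSet_iff.1 hh)

variable (L) in
/-- Every run of North-East steps starts at an even weight. -/
def AscentsEven : Prop :=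
  ∀ w, L.steps[w]? = some Step.NE → (w = 0 ∨ L.steps[w - 1]? ≠ some Step.NE) → Even w

/-- The saddle which determines the relative height is the start of an ascent, and there is no
East step between the saddle and the peak. -/
theorem AscentsEven.parity (hL : L.AscentsEven) {x : ℕ} (hx : L.IsPeak x) :
    Even (x : ℤ) ↔ Even (L.relHeight x) := by
  obtain ⟨hmem, hub⟩ := L.isGreatest_relHeight hx
  rw [mem_relHeightSet_iff] at hmem
  have hxl := hx.lt_length
  have hx0 := hx.1
  have hmy : 1 ≤ L.relHeight x := by
    refine hub (mem_relHeightSet_iff.2 ⟨⟨x - 1, by omega, hx.height_pred, fun z _ _ => ?_⟩,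
      ⟨x + 1, by omega, by omega, hx.height_succ, fun z _ _ => ?_⟩⟩) <;> omega
  obtain ⟨m, hm⟩ : ∃ m, m = L.height x - L.relHeight x := ⟨_, rfl⟩
  have hnot : ¬(LeftReach L x (m - 1) ∧ RightReach L x (m - 1)) := by
    intro h
    have h1 : L.relHeight x + 1 ∈ L.relHeightSet x := by
      rw [mem_relHeightSet_iff, show L.height x - (L.relHeight x + 1) = m - 1 by omega]
      exact h
    have := hub h1
    omega
  rw [← hm] at hmem
  obtain ⟨⟨x₁, h1, h2, h3⟩, ⟨x₂, h4, h5, h6, h7⟩⟩ := hmem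
  by_cases hleft : LeftReach L x (m - 1)
  · -- the saddle is to the right
    have hm0 : 1 ≤ m := by
      obtain ⟨y, hy, hy', -⟩ := hleft
      have := height_nonneg' (L := L) (x := y) (by omega)
      omega
    obtain ⟨w, hw1, hw2, hw3, hw4⟩ := exists_first_height_eq (L := L) (m := m) h4.le h5
      (by omega) h6.le
    have hxw : x < w := by
      rcases hw1.eq_or_lt with rfl | h
      · omega
      · exact h
    have hwl : w < L.steps.length := by
      by_contra! hlt
      have := L.height_end
      change L.height L.steps.length = 0 at this
      rw [show w = L.steps.length by omega] at hw3
      omega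
    have hNE : L.steps[w]? = some Step.NE := by
      rcases step_cases hwl with h | h | h
      · exact h.1
      · refine absurd ⟨hleft, w + 1, by omega, by omega, by omega, fun z hz1 hz2 hz => ?_⟩ hnot
        rcases (Nat.lt_succ_iff.1 hz2).eq_or_lt with rfl | hz2
        · omega
        · exact h7 z hz1 (by omega) hz
      · omega
    have hprev : L.steps[w - 1]? ≠ some Step.NE := by
      intro h
      have h8 := L.height_succ h
      rw [Nat.sub_add_cancel (by omega)] at h8
      simp only [Step.rise] at h8
      have := hw4 (w - 1) (by omega) (by omega)
      omega
    have heven := hL w hNE (Or.inr hprev)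
    have hpar := even_height_sub (L := L) hw1 hwl.le fun i hi1 hi2 =>
      steps_ne_E_of_pos (by have := hw4 i hi1 hi2; omega)
    rw [Nat.even_iff] at heven
    rw [Int.even_iff] at hpar
    rw [Int.even_iff, Int.even_iff]
    omega
  · -- the saddle is to the left
    obtain ⟨w, hw1, hw2, hw3, hw4⟩ := exists_last_height_eq (L := L) (m := m) h1.le hxl.le
      h2.le (by omega)
    have hxw : w < x := by
      rcases hw2.eq_or_lt with rfl | h
      · omega
      · exact h
    have hw0 := height_nonneg' (L := L) (x := w) (by omega)
    have hNE : L.steps[w]? = some Step.NE := by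
      have h8 := hw4 (w + 1) (by omega) (by omega)
      rcases step_cases (L := L) (x := w) (by omega) with h | h | h
      · exact h.1
      · omega
      · omega
    have hprev : w = 0 ∨ L.steps[w - 1]? ≠ some Step.NE := by
      by_contra! h
      have h8 := L.height_succ h.2
      rw [Nat.sub_add_cancel (by omega)] at h8
      simp only [Step.rise] at h8
      refine hleft ⟨w - 1, by omega, by omega, fun z hz1 hz2 hz => ?_⟩
      rcases (show w ≤ z by omega).eq_or_lt with rfl | hz1
      · have := hz.2.2
        rw [hNE] at this
        simp at this
      · exact h3 z (by omega) hz2 hz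
    have heven := hL w hNE hprev
    have hpar := even_height_sub (L := L) hw2 hxl.le fun i hi1 hi2 => by
      rcases hi1.eq_or_lt with rfl | hi1
      · rw [hNE]
        simp
      · exact steps_ne_E_of_pos (by have := hw4 i hi1 hi2.le; omega)
    rw [Nat.even_iff] at heven
    rw [Int.even_iff] at hpar
    rw [Int.even_iff, Int.even_iff]
    omega

/-- Every start of an ascent is the saddle of some peak: of the highest peak of the mountain to its
right or of the mountain to its left, whichever is lower. -/
theorem ascentsEven_of_parity (hL : ∀ x, L.IsPeak x → (Even (x : ℤ) ↔ Even (L.relHeight x))) :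
    L.AscentsEven := by
  intro w hNE hprev
  rcases Nat.eq_zero_or_pos w with rfl | hw0
  · exact Even.zero
  replace hprev := hprev.resolve_left (by omega)
  have hwl : w < L.steps.length := (List.getElem?_eq_some_iff.1 hNE).1
  have hw1 := L.height_succ hNE
  simp only [Step.rise] at hw1
  obtain ⟨m, hm⟩ : ∃ m, L.height w = m := ⟨_, rfl⟩
  have hm0 := height_nonneg' (L := L) hwl.le
  have hend := L.height_end
  change L.height L.steps.length = 0 at hend
  obtain ⟨r, hr1, hr2, hr3, hr4⟩ := exists_first_height_eq (L := L) (m := m) (a := w + 1)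
    (b := L.steps.length) hwl le_rfl (by omega) (by omega)
  have hwr : w + 1 < r := by
    rcases hr1.eq_or_lt with rfl | h
    · omega
    · exact h
  obtain ⟨x, hx1, hx2, hx, hx3, hx4⟩ := exists_isPeak_max hwr hr2 hm hr3
    fun z h1 h2 => hr4 z h1 h2
  -- If a higher peak to the left hides what is lower, then `w` is the saddle of `x`.
  have main : (∀ x₁ < w, L.height x₁ < m →
      ∃ z, x₁ < z ∧ z < w ∧ L.IsPeak z ∧ L.height x ≤ L.height z) → Even w := by
    intro hhide
    have hrel : L.relHeight x = L.height x - m := by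
      refine relHeight_eq hx ⟨w, hx1, hm, fun z hz1 hz2 _ => hx4 z hz1.le hz2⟩
        ⟨r, hx2, hr2, hr3, fun z hz1 hz2 _ => hx3 z (by omega) hz2.le⟩ ?_
      rintro m' hm' ⟨⟨x₁, h1, h2, h3⟩, -⟩
      rcases lt_trichotomy x₁ w with h | rfl | h
      · obtain ⟨z, hz1, hz2, hz3, hz4⟩ := hhide x₁ h (by omega)
        have := h3 z hz1 (by omega) hz3
        omega
      · omega
      · have := hr4 x₁ h (by omega)
        omega
    have hpar := even_height_sub (L := L) hx1.le (by omega) fun i hi1 hi2 => by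
      rcases hi1.eq_or_lt with rfl | hi1
      · rw [hNE]
        simp
      · exact steps_ne_E_of_pos (by have := hr4 i hi1 (by omega); omega)
    have h := hL x hx
    rw [Int.even_iff] at hpar
    rw [Int.even_iff, Int.even_iff] at h
    rw [Nat.even_iff]
    omega
  by_cases hlow : ∃ l < w, L.height l ≤ m
  swap
  · push Not at hlow
    exact main fun x₁ h1 h2 => absurd (hlow x₁ h1) (by omega)
  have hpc := step_cases (L := L) (x := w - 1) (by omega)
  rw [Nat.sub_add_cancel hw0] at hpc
  rcases hpc with h | h | h
  · exact absurd h.1 hprev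
  swap
  · refine main fun x₁ h1 h2 => ?_
    have := height_nonneg' (L := L) (x := x₁) (by omega)
    omega
  obtain ⟨l₀, hl1, hl2⟩ := hlow
  obtain ⟨l, hl3, hl4, hl5, hl6⟩ := exists_last_height_eq (L := L) (m := m) (a := l₀) (b := w - 1)
    (by omega) (by omega) hl2 (by omega)
  have hlw : l + 1 < w := by
    rcases hl4.eq_or_lt with rfl | h'
    · omega
    · omega
  obtain ⟨y, hy1, hy2, hy, hy3, hy4⟩ := exists_isPeak_max hlw hwl.le hl5 hm
    fun z h1 h2 => hl6 z h1 (by omega)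
  by_cases hxy : L.height x ≤ L.height y
  · refine main fun x₁ h1 h2 => ⟨y, ?_, hy2, hy, hxy⟩
    by_contra! hlt
    have := hl6 x₁ (by omega) (by omega)
    omega
  · have hrel : L.relHeight y = L.height y - m := by
      refine relHeight_eq hy ⟨l, hy1, hl5, fun z hz1 hz2 _ => hy4 z hz1.le hz2⟩
        ⟨w, hy2, hwl.le, hm, fun z hz1 hz2 _ => hy3 z (by omega) hz2.le⟩ ?_
      rintro m' hm' ⟨-, ⟨x₂, h1, h2, h3, h4⟩⟩
      rcases lt_or_ge x x₂ with h5 | h5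
      · have := h4 x (by omega) h5 hx
        omega
      · rcases lt_trichotomy x₂ w with h6 | rfl | h6
        · have := hl6 x₂ (by omega) (by omega)
          omega
        · omega
        · have := hr4 x₂ h6 (by omega)
          omega
    have hpar := even_height_sub (L := L) hy2.le hwl.le fun i hi1 hi2 =>
      steps_ne_E_of_pos (by have := hl6 i (by omega) (by omega); omega)
    have h := hL y hy
    rw [Int.even_iff] at hpar
    rw [Int.even_iff, Int.even_iff] at h
    rw [Nat.even_iff]
    omega

end LatticePath

/-! ### Lattice paths as lists of steps -/

theorem heightAt_cons {s s' : ℕ} {t : Step} (h : (s : ℤ) + t.rise = s') (l : List Step) (x : ℕ) :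
    heightAt s (t :: l) (x + 1) = heightAt s' l x := by
  simp [heightAt, ← h, add_assoc]

theorem heightAt_zero (s : ℕ) (l : List Step) : heightAt s l 0 = s := by
  simp [heightAt]

/-- The conditions which `IsPathFrom` collects along the list, stated vertex by vertex. -/
structure IsPathVertexwise (k w : ℕ) (u : Bool) (s : ℕ) (l : List Step) : Prop where
  nonneg : ∀ x ≤ l.length, 0 ≤ heightAt s l x
  lt : ∀ x ≤ l.length, heightAt s l x < k
  east : ∀ x, l[x]? = some Step.E → heightAt s l x = 0
  height_end : heightAt s l l.length = 0
  empty_or_end : l = [] ∨ l.getLast? = some Step.SE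
  ascent : ∀ x, l[x]? = some Step.NE →
    (x = 0 ∧ u = true) ∨ (0 < x ∧ l[x - 1]? = some Step.NE) ∨ Even (w + x)

theorem isPathVertexwise_cons {k w s s' : ℕ} {u : Bool} {t : Step} {l : List Step}
    (h : (s : ℤ) + t.rise = s') : IsPathVertexwise k w u s (t :: l) ↔
      s < k ∧ (t = Step.E → s = 0) ∧ (l = [] → t = Step.SE) ∧
        (t = Step.NE → u = true ∨ Even w) ∧
        IsPathVertexwise k (w + 1) (decide (t = Step.NE)) s' l := by
  constructor
  · rintro ⟨h1, h2, h3, h4, h5, h6⟩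
    refine ⟨?_, ?_, ?_, ?_, ⟨fun x hx => ?_, fun x hx => ?_, fun x hx => ?_, ?_, ?_, ?_⟩⟩
    · simpa [heightAt_zero] using h2 0 (by simp)
    · rintro rfl
      simpa [heightAt_zero] using h3 0 (by simp)
    · rintro rfl
      simpa using h5
    · rintro rfl
      simpa using h6 0 (by simp)
    · simpa [heightAt_cons h] using h1 (x + 1) (by simpa using hx)
    · simpa [heightAt_cons h] using h2 (x + 1) (by simpa using hx)
    · simpa [heightAt_cons h] using h3 (x + 1) (by simpa using hx)
    · simpa [heightAt_cons h] using h4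
    · rcases l with _ | ⟨b, l⟩
      · simp
      · simpa using h5
    · intro x hx
      have := h6 (x + 1) (by simpa using hx)
      rcases x with _ | x
      · simpa using this
      · simpa [show w + (x + 1 + 1) = w + 1 + (x + 1) by ring] using this
  · rintro ⟨h1, h2, h3, h4, ⟨h5, h6, h7, h8, h9, h10⟩⟩
    refine ⟨fun x hx => ?_, fun x hx => ?_, fun x hx => ?_, ?_, ?_, ?_⟩
    · rcases x with _ | x
      · simp [heightAt_zero]
      · rw [heightAt_cons h]
        exact h5 x (by simpa using hx)
    · rcases x with _ | x
      · simpa [heightAt_zero] using h1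
      · rw [heightAt_cons h]
        exact h6 x (by simpa using hx)
    · rcases x with _ | x
      · simpa [heightAt_zero] using h2 (by simpa using hx)
      · rw [heightAt_cons h]
        exact h7 x (by simpa using hx)
    · rw [List.length_cons, heightAt_cons h, h8]
    · rcases l with _ | ⟨b, l⟩
      · simp [h3 rfl]
      · simpa using h9
    · intro x hx
      rcases x with _ | x
      · have := h4 (by simpa using hx)
        simpa using this
      · have := h10 x (by simpa using hx)
        rcases x with _ | x
        · simpa using this
        · simpa [show w + (x + 1 + 1) = w + 1 + (x + 1) by ring] using this

theorem isPathFrom_iff {k w s : ℕ} {u : Bool} {l : List Step} (hs : s < k)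
    (hu : u = true → 1 ≤ s) : IsPathFrom k w u s l ↔ IsPathVertexwise k w u s l := by
  induction l generalizing w s u with
  | nil =>
    constructor
    · rintro ⟨rfl, rfl⟩
      refine ⟨?_, ?_, ?_, ?_, Or.inl rfl, ?_⟩ <;> simp [heightAt, hs]
    · intro h
      have h1 := h.height_end
      simp only [heightAt, List.take_nil, List.map_nil, List.sum_nil, add_zero,
        Nat.cast_eq_zero] at h1
      refine ⟨h1, ?_⟩
      cases u
      · rfl
      · have := hu rfl
        omega
  | cons t l ih =>
    rcases t with _ | _ | _
    · rw [isPathVertexwise_cons (s' := s + 1) (by simp [Step.rise]), IsPathFrom]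
      constructor
      · rintro ⟨h1, h2, h3⟩
        have h4 := (ih h1 (by simp)).1 h3
        refine ⟨hs, by simp, ?_, fun _ => h2, by simpa using h4⟩
        rintro rfl
        simp [IsPathFrom] at h3
      · rintro ⟨-, -, h2, h3, h4⟩
        have h5 : s + 1 < k := by
          have := h4.lt 0 (by simp)
          rw [heightAt_zero] at this
          omega
        exact ⟨h5, h3 rfl, (ih h5 (by simp)).2 (by simpa using h4)⟩
    · rcases s with _ | s
      · constructor
        · rintro ⟨h1, -⟩
          omega
        · intro h
          have := h.nonneg 1 (by simp)
          simp [heightAt, Step.rise] at this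
      · rw [isPathVertexwise_cons (s' := s) (by simp [Step.rise]), IsPathFrom, Nat.add_sub_cancel,
          ih (by omega) (by simp)]
        simp [hs]
    · rw [isPathVertexwise_cons (s' := s) (by simp [Step.rise]), IsPathFrom]
      constructor
      · rintro ⟨rfl, rfl, h1, h2⟩
        exact ⟨hs, by simp, fun h => absurd h h1, by simp,
          by simpa using (ih hs (by simp)).1 h2⟩
      · rintro ⟨-, h1, h2, -, h3⟩
        obtain rfl := h1 rfl
        refine ⟨?_, rfl, fun h => by simpa using h2 h, (ih hs (by simp)).2 (by simpa using h3)⟩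
        cases u
        · rfl
        · simpa using hu rfl

theorem sum_peaks_eq_peakSum (w : ℕ) (u : Bool) (l : List Step) :
    (∑ x ∈ Finset.range l.length, if l[x]? = some Step.SE ∧
      ((x = 0 ∧ u = true) ∨ (0 < x ∧ l[x - 1]? = some Step.NE)) then w + x else 0) =
      peakSum w u l := by
  induction l generalizing w u with
  | nil => simp [peakSum]
  | cons t l ih =>
    have h : peakSum w u (t :: l) = (if t = Step.SE ∧ u = true then w else 0) +
        peakSum (w + 1) (decide (t = Step.NE)) l := by
      cases t <;> simp [peakSum]
    rw [h, ← ih, List.length_cons, Finset.sum_range_succ', add_comm]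
    congr 1
    · simp
    · refine Finset.sum_congr rfl fun x _ => ?_
      rcases x with _ | x
      · simp
      · simp [show w + (x + 1 + 1) = w + 1 + (x + 1) by ring]

theorem LatticePath.majorIndex_eq_peakSum (L : LatticePath) :
    L.majorIndex = peakSum 0 false L.steps := by
  rw [← sum_peaks_eq_peakSum, LatticePath.majorIndex, Finset.sum_filter]
  refine Finset.sum_congr rfl fun x _ => ?_
  simp only [LatticePath.IsPeak, zero_add, Bool.false_eq_true, and_false, false_or]
  congr 1
  rw [eq_iff_iff]
  tauto

/-- A path counted by `P k a n` is determined by its list of steps. -/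
theorem image_steps_parityPaths {k a n : ℕ} (ha : 1 ≤ a) (hak : a ≤ k) :
    LatticePath.steps '' parityPaths k a n =
      {l ∈ pathSet k 0 false (k - a) | peakSum 0 false l = n} := by
  ext l
  constructor
  · rintro ⟨L, ⟨⟨h1, h2⟩, h3, h4⟩, rfl⟩
    have hstart : L.start = k - a := by omega
    refine ⟨?_, by rw [← h3, L.majorIndex_eq_peakSum]⟩
    refine (isPathFrom_iff (by omega) (by simp)).2 ?_
    rw [← hstart]
    refine ⟨L.height_nonneg, h2, L.east_height, L.height_end, L.empty_or_end, fun x hx => ?_⟩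
    have h5 := LatticePath.ascentsEven_of_parity h4 x hx
    by_cases hx0 : 0 < x ∧ L.steps[x - 1]? = some Step.NE
    · exact Or.inr (Or.inl hx0)
    · right
      right
      rw [zero_add]
      refine h5 ?_
      by_contra! h6
      exact hx0 ⟨by omega, h6.2⟩
  · rintro ⟨hl, hn⟩
    obtain ⟨h1, h2, h3, h4, h5, h6⟩ := (isPathFrom_iff (by omega) (by simp)).1 hl
    refine ⟨⟨k - a, l, h1, h3, h4, h5⟩, ⟨⟨by simp only; omega, h2⟩, ?_, fun x hx => ?_⟩, rfl⟩
    · rw [LatticePath.majorIndex_eq_peakSum, hn]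
    · refine LatticePath.AscentsEven.parity (fun w hw hw' => ?_) hx
      rcases h6 w hw with h7 | h7 | h7
      · simp at h7
      · rcases hw' with rfl | hw'
        · exact Even.zero
        · exact absurd h7.2 hw'
      · simpa using h7

theorem injOn_steps_parityPaths (k a n : ℕ) :
    Set.InjOn LatticePath.steps (parityPaths k a n) := by
  intro L hL L' hL' h
  have h1 := hL.1.1
  have h2 := hL'.1.1
  exact LatticePath.ext (by omega) h

theorem parityPaths_finite {k a : ℕ} (ha : 1 ≤ a) (hak : a ≤ k) (n : ℕ) :
    (parityPaths k a n).Finite := by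
  refine Set.Finite.of_finite_image ?_ (injOn_steps_parityPaths k a n)
  rw [image_steps_parityPaths ha hak]
  exact pathSet_finite (by omega) n

theorem P_eq_coeff {d a : ℕ} (ha : 1 ≤ a) (hak : a ≤ d + 1) (n : ℕ) :
    (P (d + 1) a n : ℤ) = PowerSeries.coeff n (pathSum d a 0) := by
  have h := genFun_pathSet_eq (d := d) (h := d + 1 - a) (by omega)
  rw [show d + 1 - (d + 1 - a) = a by omega] at h
  rw [← h, genFun, PowerSeries.coeff_mk, P, ← (injOn_steps_parityPaths _ _ _).ncard_image,
    image_steps_parityPaths ha hak]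

/-! ### The two expansions of the multisum -/

namespace MultiIndex

variable {d : ℕ}

theorem entry_eq (N : MultiIndex (d + 1)) (i : Fin d) : N.entry (i + 1) = N.1 i := by
  rw [entry, dif_pos ⟨by omega, by omega⟩]
  rfl

theorem entry_of_lt (N : MultiIndex (d + 1)) {i : ℕ} (h : d < i) : N.entry i = 0 := by
  rw [entry, dif_neg (by omega)]

theorem entry_anti (N : MultiIndex (d + 1)) {i j : ℕ} (hi : 1 ≤ i) (h : i ≤ j) :
    N.entry j ≤ N.entry i := by
  by_cases hj : j ≤ d
  · rw [entry, entry, dif_pos ⟨by omega, by omega⟩, dif_pos ⟨by omega, by omega⟩]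
    exact N.2 (Fin.mk_le_mk.2 (by omega))
  · rw [N.entry_of_lt (by omega)]
    exact Nat.zero_le _

theorem ext_entry {N M : MultiIndex (d + 1)} (h : ∀ i, 1 ≤ i → i ≤ d → N.entry i = M.entry i) :
    N = M := by
  ext i
  have hi : (i : ℕ) < d := i.2
  have := h (i + 1) (by omega) (by omega)
  rwa [entry_eq N i, entry_eq M i] at this

/-- The multi-index with entries `f 1, …, f d`. -/
def ofFun (f : ℕ → ℕ) (hf : ∀ i, 1 ≤ i → i + 1 ≤ d → f (i + 1) ≤ f i) : MultiIndex (d + 1) :=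
  ⟨fun i => f (i + 1), by
    have key : ∀ i n, 1 ≤ i → i + n ≤ d → f (i + n) ≤ f i := by
      intro i n hi
      induction n with
      | zero => exact fun _ => le_rfl
      | succ n ih => exact fun h => (hf (i + n) (by omega) h).trans (ih (by omega))
    intro i j hij
    obtain ⟨n, hn⟩ := Nat.exists_eq_add_of_le (Fin.le_def.1 hij)
    have hj : (j : ℕ) < d := j.2
    have := key (i + 1) n (by omega) (by omega)
    rwa [show (i : ℕ) + 1 + n = j + 1 by omega] at this⟩

theorem entry_ofFun {f : ℕ → ℕ} (hf : ∀ i, 1 ≤ i → i + 1 ≤ d → f (i + 1) ≤ f i) {i : ℕ}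
    (h1 : 1 ≤ i) (h2 : i ≤ d) : (ofFun (d := d) f hf).entry i = f i := by
  rw [entry, dif_pos ⟨h1, by omega⟩]
  simp only [ofFun]
  rw [Nat.sub_add_cancel h1]

/-- The sum of all entries. -/
def total (N : MultiIndex (d + 1)) : ℕ := ∑ i ∈ Finset.Icc 1 d, N.entry i

theorem finite_total_le (n : ℕ) : {N : MultiIndex (d + 1) | N.total ≤ n}.Finite := by
  refine ((Set.finite_Iic (fun _ : Fin d => n)).preimage
    (f := fun N : MultiIndex (d + 1) => N.1) Subtype.val_injective.injOn).subset ?_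
  intro N hN i
  have hi : (i : ℕ) < d := i.2
  show N.1 i ≤ n
  rw [← N.entry_eq i]
  exact (Finset.single_le_sum (f := N.entry) (fun _ _ => Nat.zero_le _)
    (Finset.mem_Icc.2 ⟨by omega, by omega⟩)).trans hN

theorem X_pow_total_dvd_summand (a : ℕ) (N : MultiIndex (d + 1)) :
    (X : ℤ⟦X⟧) ^ N.total ∣ N.summand a := by
  refine (pow_dvd_pow _ ?_).mul_right _
  refine le_trans ?_ (Nat.le_add_right _ _)
  exact Finset.sum_le_sum fun i _ => Nat.le_self_pow two_ne_zero _

theorem summable_mul_summand (a : ℕ) (g : MultiIndex (d + 1) → ℤ⟦X⟧) :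
    Summable fun N => g N * N.summand a :=
  summable_of_X_pow_dvd total finite_total_le fun N => (X_pow_total_dvd_summand a N).mul_left _

instance : Subsingleton (MultiIndex (0 + 1)) :=
  ⟨fun _ _ => ext_entry fun _ _ _ => by omega⟩

theorem summand_zero {a : ℕ} (ha : 1 ≤ a) (N : MultiIndex (0 + 1)) : N.summand a = 1 := by
  simp [summand, exponent, Finset.Icc_eq_empty (show ¬ a ≤ 0 by omega)]

theorem total_zero (N : MultiIndex (0 + 1)) : N.total = 0 := by
  simp [total]

/-! ### Lowering all entries by the last one -/

/-- Raise all entries of `N` by `n`, and append `n`. -/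
def raise (n : ℕ) (N : MultiIndex (d + 1)) : MultiIndex (d + 1 + 1) :=
  ofFun (fun i => N.entry i + n) fun _ hi _ => Nat.add_le_add_right (N.entry_anti hi (by omega)) n

theorem entry_raise (n : ℕ) (N : MultiIndex (d + 1)) {i : ℕ} (h1 : 1 ≤ i) (h2 : i ≤ d + 1) :
    (raise n N).entry i = N.entry i + n := entry_ofFun _ h1 h2

theorem raise_bijective :
    Function.Bijective fun p : ℕ × MultiIndex (d + 1) => raise p.1 p.2 := by
  constructor
  · rintro ⟨n, N⟩ ⟨n', N'⟩ h
    simp only at h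
    have h1 : ∀ i, 1 ≤ i → i ≤ d + 1 → N.entry i + n = N'.entry i + n' := by
      intro i hi hi'
      rw [← entry_raise n N hi hi', h, entry_raise n' N' hi hi']
    have h2 := h1 (d + 1) (by omega) le_rfl
    rw [N.entry_of_lt (by omega), N'.entry_of_lt (by omega)] at h2
    obtain rfl : n = n' := by omega
    refine Prod.ext rfl (ext_entry fun i hi hi' => ?_)
    have := h1 i hi (by omega)
    show N.entry i = N'.entry i
    omega
  · intro M
    refine ⟨(M.entry (d + 1), ofFun (fun i => M.entry i - M.entry (d + 1)) fun i hi _ =>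
      Nat.sub_le_sub_right (M.entry_anti hi (by omega)) _), ext_entry fun i hi hi' => ?_⟩
    rw [entry_raise _ _ hi hi']
    have h1 := M.entry_anti hi hi'
    rcases hi'.eq_or_lt with rfl | hlt
    · rw [entry_of_lt _ (by omega), zero_add]
    · rw [entry_ofFun _ hi (by omega)]
      omega

/-- The number of linear terms in the exponent of the multisum for `k = d + 2`. -/
theorem card_filter_mod (d a : ℕ) :
    ((Finset.Icc a (d + 1)).filter fun i => i % 2 = a % 2).card = (d + 3 - a) / 2 := by
  induction d with
  | zero =>
    rcases Nat.lt_or_ge 1 a with h | h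
    · rw [Finset.Icc_eq_empty (by omega), Finset.filter_empty, Finset.card_empty]
      omega
    · interval_cases a <;> rfl
  | succ d ih =>
    rcases Nat.lt_or_ge (d + 1 + 1) a with h | h
    · rw [Finset.Icc_eq_empty (by omega), Finset.filter_empty, Finset.card_empty]
      omega
    · have hI : Finset.Icc a (d + 1 + 1) = insert (d + 1 + 1) (Finset.Icc a (d + 1)) := by
        ext i
        simp only [Finset.mem_insert, Finset.mem_Icc]
        omega
      rw [hI, Finset.filter_insert]
      split_ifs with hp
      · rw [Finset.card_insert_of_notMem (by simp), ih]
        omega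
      · rw [ih]
        omega

theorem total_raise (n : ℕ) (N : MultiIndex (d + 1)) :
    (raise n N).total = N.total + (d + 1) * n := by
  rw [total, Finset.sum_congr rfl fun i hi => entry_raise n N (Finset.mem_Icc.1 hi).1
    (Finset.mem_Icc.1 hi).2, Finset.sum_add_distrib, Finset.sum_Icc_succ_top (by omega),
    N.entry_of_lt (by omega), total]
  simp

theorem exponent_raise {a : ℕ} (ha : 1 ≤ a) (n : ℕ) (N : MultiIndex (d + 1)) :
    (raise n N).exponent a = N.exponent a + 2 * n * N.total + (d + 1) * n ^ 2 +
      2 * n * ((d + 3 - a) / 2) := by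
  have h1 : ∑ i ∈ Finset.Icc 1 (d + 1), (raise n N).entry i ^ 2 =
      ∑ i ∈ Finset.Icc 1 d, N.entry i ^ 2 + 2 * n * N.total + (d + 1) * n ^ 2 := by
    have : ∀ i ∈ Finset.Icc 1 (d + 1), (raise n N).entry i ^ 2 =
        N.entry i ^ 2 + 2 * n * N.entry i + n ^ 2 := by
      intro i hi
      rw [entry_raise n N (Finset.mem_Icc.1 hi).1 (Finset.mem_Icc.1 hi).2]
      ring
    rw [Finset.sum_congr rfl this, Finset.sum_add_distrib, Finset.sum_add_distrib,
      Finset.sum_Icc_succ_top (by omega), Finset.sum_Icc_succ_top (by omega),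
      N.entry_of_lt (by omega), total, Finset.mul_sum]
    simp
  have h2 : ∑ i ∈ (Finset.Icc a (d + 1)).filter (fun i => i % 2 = a % 2), 2 * (raise n N).entry i =
      ∑ i ∈ (Finset.Icc a d).filter (fun i => i % 2 = a % 2), 2 * N.entry i +
        2 * n * ((d + 3 - a) / 2) := by
    have : ∀ i ∈ (Finset.Icc a (d + 1)).filter (fun i => i % 2 = a % 2),
        2 * (raise n N).entry i = 2 * N.entry i + 2 * n := by
      intro i hi
      have := Finset.mem_Icc.1 (Finset.mem_filter.1 hi).1
      rw [entry_raise n N (by omega) this.2]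
      ring
    rw [Finset.sum_congr rfl this, Finset.sum_add_distrib, Finset.sum_const, card_filter_mod,
      smul_eq_mul, mul_comm (2 * n)]
    congr 1
    symm
    refine Finset.sum_subset ?_ ?_
    · exact Finset.filter_subset_filter _ (Finset.Icc_subset_Icc le_rfl (by omega))
    · intro i hi hi'
      simp only [Finset.mem_filter, Finset.mem_Icc] at hi hi'
      rw [N.entry_of_lt (by omega), mul_zero]
  simp only [exponent, Nat.add_sub_cancel]
  rw [h1, h2]
  ring

/-- Raising all entries by `n` changes the specialisation `x = q^{2m}` into `x = q^{2(m+n)}`. -/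
theorem summand_raise {a : ℕ} (ha : 1 ≤ a) (m n : ℕ) (N : MultiIndex (d + 1)) :
    X ^ (2 * m * (raise n N).total) * (raise n N).summand a =
      X ^ ((d + 1) * (n ^ 2 + 2 * m * n)) * invQQPoch n * X ^ (2 * n * ((d + 3 - a) / 2)) *
        (X ^ (2 * (m + n) * N.total) * N.summand a) := by
  have h : ∏ i ∈ Finset.Icc 1 (d + 1),
      invQQPoch ((raise n N).entry i - (raise n N).entry (i + 1)) =
      (∏ i ∈ Finset.Icc 1 d, invQQPoch (N.entry i - N.entry (i + 1))) * invQQPoch n := by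
    rw [Finset.prod_Icc_succ_top (by omega), entry_raise n N (by omega) le_rfl,
      entry_of_lt _ (show d + 1 < d + 1 + 1 by omega), N.entry_of_lt (by omega), zero_add,
      Nat.sub_zero]
    congr 1
    refine Finset.prod_congr rfl fun i hi => ?_
    have hi := Finset.mem_Icc.1 hi
    rw [entry_raise n N hi.1 (by omega), entry_raise n N (by omega) (by omega),
      Nat.add_sub_add_right]
  simp only [summand, Nat.add_sub_cancel]
  rw [h, exponent_raise ha, total_raise]
  ring

theorem hasSum_summand_gordonSum {a : ℕ} (ha : 1 ≤ a) (m : ℕ) :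
    HasSum (fun N : MultiIndex (d + 1) => X ^ (2 * m * N.total) * N.summand a)
      (gordonSum d a m) := by
  induction d generalizing m with
  | zero =>
    convert hasSum_single (ofFun (d := 0) (fun _ => 0) (by simp)) ?_ using 1
    · rw [summand_zero ha, total_zero, gordonSum, if_neg (by omega)]
      simp
    · exact fun N hN => absurd (Subsingleton.elim _ _) hN
  | succ d ih =>
    have hs := summable_mul_summand (d := d + 1) a fun N => X ^ (2 * m * N.total)
    have h1 := ((Equiv.ofBijective _ (raise_bijective (d := d))).hasSum_iff.2 hs.hasSum)
    have h2 := h1.prod_fiberwise (g := fun n => X ^ ((d + 1) * (n ^ 2 + 2 * m * n)) *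
      invQQPoch n * X ^ (2 * n * ((d + 3 - a) / 2)) * gordonSum d a (m + n)) fun n => by
        have h3 := (ih (m + n)).mul_left (X ^ ((d + 1) * (n ^ 2 + 2 * m * n)) *
          invQQPoch n * X ^ (2 * n * ((d + 3 - a) / 2)))
        simp only [← summand_raise ha] at h3
        exact h3
    rw [gordonSum, h2.tsum_eq]
    exact hs.hasSum

/-! ### Splitting off the first entry -/

/-- Remove the first entry. -/
def tail (N : MultiIndex (d + 1 + 1)) : MultiIndex (d + 1) :=
  ofFun (fun i => N.entry (i + 1)) fun _ _ _ => N.entry_anti (by omega) (by omega)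

theorem entry_tail (N : MultiIndex (d + 1 + 1)) {i : ℕ} (h1 : 1 ≤ i) :
    N.tail.entry i = N.entry (i + 1) := by
  rcases Nat.lt_or_ge d i with h | h
  · rw [entry_of_lt _ h, entry_of_lt _ (by omega)]
  · exact entry_ofFun _ h1 h

theorem tail_injective :
    Function.Injective fun N : MultiIndex (d + 1 + 1) => (N.entry 1, N.tail) := by
  intro N M h
  obtain ⟨h1, h2⟩ := Prod.ext_iff.1 h
  simp only at h1 h2
  refine ext_entry fun i hi hi' => ?_
  rcases hi.eq_or_lt with rfl | hlt
  · exact h1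
  · obtain ⟨j, rfl⟩ : ∃ j, i = j + 1 := ⟨i - 1, by omega⟩
    rw [← N.entry_tail (by omega), ← M.entry_tail (by omega), h2]

theorem mem_range_tail {n : ℕ} {N : MultiIndex (d + 1)} (h : N.entry 1 ≤ n) :
    (n, N) ∈ Set.range fun N : MultiIndex (d + 1 + 1) => (N.entry 1, N.tail) := by
  let f : ℕ → ℕ := fun i => if i = 1 then n else N.entry (i - 1)
  have hf : ∀ i, 1 ≤ i → i + 1 ≤ d + 1 → f (i + 1) ≤ f i := by
    intro i hi _
    simp only [f, Nat.add_sub_cancel, show i + 1 ≠ 1 by omega, if_false]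
    split_ifs with h1
    · rwa [h1]
    · exact N.entry_anti (by omega) (by omega)
  refine ⟨ofFun f hf, Prod.ext ?_ (ext_entry fun i hi hi' => ?_)⟩
  · exact entry_ofFun hf le_rfl (by omega)
  · rw [entry_tail _ hi, entry_ofFun hf (by omega) (by omega)]
    simp [f, show i ≠ 0 by omega]

@[to_additive]
theorem prod_Icc_succ_bot {M : Type*} [CommMonoid M] (f : ℕ → M) (d : ℕ) :
    ∏ i ∈ Finset.Icc 1 (d + 1), f i = f 1 * ∏ i ∈ Finset.Icc 1 d, f (i + 1) := by
  induction d with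
  | zero => simp
  | succ d ih =>
    rw [Finset.prod_Icc_succ_top (by omega), ih, Finset.prod_Icc_succ_top (by omega), mul_assoc]

/-- For `a = 1` the linear terms `N₁, N₃, N₅, …` lose `N₁`, and start with the second entry of the
tail; otherwise the index `a` is shifted. -/
theorem exponent_eq_tail {a : ℕ} (ha : 1 ≤ a) (N : MultiIndex (d + 1 + 1)) :
    N.exponent a = N.entry 1 ^ 2 + (if a = 1 then 2 * N.entry 1 else 0) +
      N.tail.exponent (if a = 1 then 2 else a - 1) := by
  have h1 : ∑ i ∈ Finset.Icc 1 (d + 1), N.entry i ^ 2 =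
      N.entry 1 ^ 2 + ∑ i ∈ Finset.Icc 1 d, N.tail.entry i ^ 2 := by
    rw [sum_Icc_succ_bot]
    congr 1
    refine Finset.sum_congr rfl fun i hi => ?_
    rw [N.entry_tail (Finset.mem_Icc.1 hi).1]
  -- with zero terms added, both linear sums start at the index `1`
  have h2 : ∀ (e : ℕ) (M : MultiIndex (e + 1)) (b : ℕ), 1 ≤ b →
      ∑ i ∈ (Finset.Icc b e).filter (fun i => i % 2 = b % 2), 2 * M.entry i =
      ∑ i ∈ Finset.Icc 1 e, if b ≤ i ∧ i % 2 = b % 2 then 2 * M.entry i else 0 := by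
    intro e M b hb
    rw [← Finset.sum_filter]
    refine Finset.sum_congr ?_ fun _ _ => rfl
    ext i
    simp only [Finset.mem_filter, Finset.mem_Icc]
    omega
  simp only [exponent, Nat.add_sub_cancel]
  rw [h1, h2 _ N a ha, h2 _ N.tail _ (by split_ifs <;> omega), sum_Icc_succ_bot]
  have h3 : ∀ i ∈ Finset.Icc 1 d,
      (if a ≤ i + 1 ∧ (i + 1) % 2 = a % 2 then 2 * N.entry (i + 1) else 0) =
      if (if a = 1 then 2 else a - 1) ≤ i ∧ i % 2 = (if a = 1 then 2 else a - 1) % 2 then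
        2 * N.tail.entry i else 0 := by
    intro i hi
    have hi := (Finset.mem_Icc.1 hi).1
    rw [N.entry_tail hi]
    refine if_congr ?_ rfl rfl
    split_ifs <;> omega
  rw [Finset.sum_congr rfl h3]
  have h4 : (if a ≤ 1 ∧ 1 % 2 = a % 2 then 2 * N.entry 1 else 0) =
      if a = 1 then 2 * N.entry 1 else 0 := if_congr (by omega) rfl rfl
  rw [h4]
  ring

theorem summand_eq_tail {a : ℕ} (ha : 1 ≤ a) (N : MultiIndex (d + 1 + 1)) :
    N.summand a = X ^ (N.entry 1 ^ 2) * X ^ (if a = 1 then 2 * N.entry 1 else 0) *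
      (invQQPoch (N.entry 1 - N.tail.entry 1) * N.tail.summand (if a = 1 then 2 else a - 1)) := by
  have h : ∏ i ∈ Finset.Icc 1 (d + 1), invQQPoch (N.entry i - N.entry (i + 1)) =
      invQQPoch (N.entry 1 - N.tail.entry 1) *
        ∏ i ∈ Finset.Icc 1 d, invQQPoch (N.tail.entry i - N.tail.entry (i + 1)) := by
    rw [prod_Icc_succ_bot, N.entry_tail le_rfl]
    congr 1
    refine Finset.prod_congr rfl fun i hi => ?_
    rw [N.entry_tail (Finset.mem_Icc.1 hi).1, N.entry_tail (by omega)]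
  simp only [summand, Nat.add_sub_cancel]
  rw [h, exponent_eq_tail ha, pow_add, pow_add]
  ring

/-- The multisum with an arbitrary additional factor depending on `N₁`. -/
theorem hasSum_summand_innerSum {a : ℕ} (ha : 1 ≤ a) (φ : ℕ → ℤ⟦X⟧) :
    HasSum (fun N : MultiIndex (d + 1) => φ (N.entry 1) * N.summand a)
      (∑' n, φ n * (X ^ (n ^ 2) * innerSum d a n)) := by
  induction d generalizing a φ with
  | zero =>
    convert hasSum_single (ofFun (d := 0) (fun _ => 0) (by simp)) ?_ using 1
    · rw [summand_zero ha, entry_of_lt _ (by omega), tsum_eq_single 0]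
      · simp [innerSum]
      · intro n hn
        simp [innerSum, hn]
    · exact fun N hN => absurd (Subsingleton.elim _ _) hN
  | succ d ih =>
    have hs := summable_mul_summand (d := d + 1) a fun N => φ (N.entry 1)
    -- the double family, extended by zero to pairs which do not satisfy `N₂ ≤ N₁`
    let Q : ℕ → ℕ → ℤ⟦X⟧ := fun n M => if M ≤ n then invQQPoch (n - M) else 0
    let b := if a = 1 then 2 else a - 1
    let G : ℕ × MultiIndex (d + 1) → ℤ⟦X⟧ := fun p =>
      φ p.1 * (X ^ (p.1 ^ 2) * X ^ (if a = 1 then 2 * p.1 else 0)) *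
        (Q p.1 (p.2.entry 1) * p.2.summand b)
    have hG : HasSum G (∑' N : MultiIndex (d + 1 + 1), φ (N.entry 1) * N.summand a) := by
      refine (tail_injective.hasSum_iff ?_).1 ?_
      · rintro ⟨n, N⟩ hN
        have : ¬ N.entry 1 ≤ n := fun h => hN (mem_range_tail h)
        simp [G, Q, this]
      · convert hs.hasSum using 1
        funext N
        have h1 : N.tail.entry 1 ≤ N.entry 1 := by
          rw [N.entry_tail le_rfl]
          exact N.entry_anti le_rfl (by omega)
        simp only [Function.comp_apply, G, Q, h1, if_true]
        rw [summand_eq_tail ha]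
        ring
    have h2 := hG.prod_fiberwise (g := fun n => φ n * (X ^ (n ^ 2) * innerSum (d + 1) a n))
      fun n => by
        have h3 := (ih (a := b) (by simp only [b]; split_ifs <;> omega) (Q n)).mul_left
          (φ n * (X ^ (n ^ 2) * X ^ (if a = 1 then 2 * n else 0)))
        have h4 : ∑' M, Q n M * (X ^ (M ^ 2) * innerSum d b M) =
            pochConv (fun M => X ^ (M ^ 2) * innerSum d b M) n := by
          rw [tsum_eq_sum (s := Finset.range (n + 1)), pochConv]
          · refine Finset.sum_congr rfl fun M hM => ?_
            have hM' : M ≤ n := Nat.lt_succ_iff.1 (Finset.mem_range.1 hM)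
            simp only [Q, hM', if_true]
          · intro M hM
            have hM' : ¬ M ≤ n := fun h => hM (Finset.mem_range.2 (Nat.lt_succ_of_le h))
            simp only [Q, hM', if_false, zero_mul]
        have h5 : φ n * (X ^ (n ^ 2) * innerSum (d + 1) a n) =
            φ n * (X ^ (n ^ 2) * X ^ (if a = 1 then 2 * n else 0)) *
              pochConv (fun M => X ^ (M ^ 2) * innerSum d b M) n := by
          rw [innerSum]
          ring
        rw [h4, ← h5] at h3
        exact h3
    rw [h2.tsum_eq]
    exact hs.hasSum

theorem hasSum_summand_pathSum {a : ℕ} (ha : 1 ≤ a) :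
    HasSum (fun N : MultiIndex (d + 1) => N.summand a) (pathSum d a 0) := by
  have h := hasSum_summand_innerSum (d := d) ha fun _ => 1
  simpa [pathSum] using h

end MultiIndex

theorem gordonSum_eq_pathSum {d a : ℕ} (ha : 1 ≤ a) : gordonSum d a 0 = pathSum d a 0 := by
  have h := MultiIndex.hasSum_summand_gordonSum (d := d) ha 0
  simp only [mul_zero, zero_mul, pow_zero, one_mul] at h
  exact h.unique (MultiIndex.hasSum_summand_pathSum ha)

end RRGPaths

theorem mainTheorem1 (k a : ℕ) (hk : 2 ≤ k) (ha : 1 ≤ a) (hak : a ≤ k) :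
    (∀ n : ℕ, (RRGPaths.parityPaths k a n).Finite ∧ RRGPaths.W k a n = RRGPaths.P k a n) ∧
      HasSum (fun N : RRGPaths.MultiIndex k => RRGPaths.MultiIndex.summand a N)
        (PowerSeries.mk fun n : ℕ => (RRGPaths.P k a n : ℤ)) := by
  obtain ⟨d, rfl⟩ : ∃ d, k = d + 1 := ⟨k - 1, by omega⟩
  refine ⟨fun n => ⟨RRGPaths.parityPaths_finite ha hak n, ?_⟩, ?_⟩
  · rw [← Nat.cast_inj (R := ℤ), RRGPaths.W_eq_coeff ha hak, RRGPaths.P_eq_coeff ha hak,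
      RRGPaths.gordonSum_eq_pathSum ha]
  · convert RRGPaths.MultiIndex.hasSum_summand_pathSum ha using 1
    ext n
    rw [PowerSeries.coeff_mk, RRGPaths.P_eq_coeff ha hak]
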